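/- **The games.** Two players A and B with budgets $0<X_A\le X_B$ compete on $n\ge 3$ battlefields; battlefield $i\in[n]$ has value $w^A_i>0$ for A and $w^B_i>0$ for B. A pure strategy of player $P\in\{A,B\}$ is a vector $x^P\in\mathbb R_{\ge0}^n$ with $\sum_i x^P_i\le X_P$; a mixed strategy is a probability distribution on pure strategies. For a pair of contest success functions $\zeta=(\zeta_A,\zeta_B)$ on $\mathbb{R}_{\ge 0}^2$, the Generalized Lottery Blotto game $\mathcal{GLB}_n^{X_A,X_B}(\zeta)$ has payoffs $\Pi_P^\zeta(x^A,x^B)=\sum_{i} w^P_i\,\zeta_P(x^A_i,x^B_i)$ for $P\in\{A,B\}$, extended to mixed strategies (drawn independently by the two players) by taking expectations. A profile $(s^*,t^*)$ of mixed strategies is an $\varepsilon$-equilibrium if $\Pi^\zeta_A(s,t^*)\le\Pi^\zeta_A(s^*,t^*)+\varepsilon$ and $\Pi^\zeta_B(s^*,t)\le\Pi^\zeta_B(s^*,t^*)+\varepsilon$ for all mixed strategies $s$ of A and $t$ of B. Write $W_P=\sum_j w^P_j$, $W=\max\{W_A,W_B\}$, $v^P_i=w^P_i/W_P$. Given $0<\underline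 w\le\bar w$, Assumption (A0) is: $\underline w\le w^P_i\le\bar w$ for all $i$ and $P$. For $\alpha\in(0,1)$ and $R>0$, the power form is $\mu^R_A(x,y)=\frac{\alpha x^R}{\alpha x^R+(1-\alpha)y^R}$, $\mu^R_B=1-\mu^R_A$, with $\mu^R_A(0,0)=\alpha$; the logit form is $\nu^R_A(x,y)=\frac{\alpha e^{Rx}}{\alpha e^{Rx}+(1-\alpha)e^{Ry}}$, $\nu^R_B=1-\nu^R_A$. **The strategies.** For $\gamma>0$ let $\Omega_A(\gamma)=\{i: v^A_i/v^B_i>\gamma\}$ and let $\mathcal S_n$ be the set of all $\gamma>0$ with $$\frac{X_B\gamma}{X_A}=\frac{\gamma^2\sum_{i\in\Omega_A(\gamma)}\frac{(v^B_i)^2}{v^A_i}+\sum_{i\notin\Omega_A(\gamma)}v^A_i}{\sum_{i\in\Omega_A(\gamma)}v^B_i+\frac1{\gamma^2}\sum_{i\notin\Omega_A(\gamma)}\frac{(v^A_i)^2}{v^B_i}}.$$ For $\gamma^*\in\mathcal S_n$ put $$\lambda_A^*=\frac{(\gamma^*)^2}{2X_B}\sum_{i\in\Omega_A(\gamma^*)}\frac{(v^B_i)^2}{v^A_i}+\frac1{2X_B}\sum_{i\notin\Omega_A(\gamma^*)}v^A_i,\qquad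 \lambda_B^*=\frac1{2X_A}\sum_{i\in\Omega_A(\gamma^*)}v^B_i+\frac1{2(\gamma^*)^2X_A}\sum_{i\notin\Omega_A(\gamma^*)}\frac{(v^A_i)^2}{v^B_i},$$ and $p_i=v^A_i/\lambda_A^*$, $q_i=v^B_i/\lambda_B^*$. If $i\in\Omega_A(\gamma^*)$, let $F_{A^*_i}$ be the uniform distribution on $[0,q_i]$ and $F_{B^*_i}$ the distribution with mass $(p_i-q_i)/p_i$ at $0$ and the remaining mass uniform on $(0,q_i]$; if $i\notin\Omega_A(\gamma^*)$, let $F_{B^*_i}$ be uniform on $[0,p_i]$ and $F_{A^*_i}$ the distribution with mass $(q_i-p_i)/q_i$ at $0$ and the remaining mass uniform on $(0,p_i]$. The strategy ${\rm IU}^{\gamma^*}_A$ draws $a_i\sim F_{A^*_i}$, $i\in[n]$, independently and plays $x^A_i=X_A\,a_i/\sum_j a_j$ (and $x^A=0$ if $\sum_j a_j=0$); ${\rm IU}^{\gamma^*}_B$ likewise draws $b_i\sim F_{B^*_i}$ independently and plays $x^B_i=X_B\,b_i/\sum_j b_j$ (and $x^B=0$ if $\sum_j b_j=0$). Put ${\rm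 IU}^{\gamma^*}=({\rm IU}^{\gamma^*}_A,{\rm IU}^{\gamma^*}_B)$. **Theorem.** Given $0<\underline w\le\bar w$, $0<X_A\le X_B$ and $\alpha\in(0,1)$, there exist constants $\tilde L>0$ and $C>0$ (depending only on these five numbers) such that for every $\bar\varepsilon\in(0,\min\{\alpha,1-\alpha\})$, every $n\ge3$, all values $(w^A_i),(w^B_i)$ satisfying (A0), and every $R$: if $$n\ge\tilde L\,\bar\varepsilon^{-2}\max\{1,\ln(1/\bar\varepsilon)\}\quad\text{and}\quad R\ge C\,\frac n{\bar\varepsilon}\ln\frac1{\bar\varepsilon},$$ then for every $\gamma^*\in\mathcal S_n$ the profile ${\rm IU}^{\gamma^*}$ is an $\bar\varepsilon W$-equilibrium of both $\mathcal{GLB}_n^{X_A,X_B}(\mu^R)$ and $\mathcal{GLB}_n^{X_A,X_B}(\nu^R)$. -/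

import Mathlib

open MeasureTheory
open scoped Classical

noncomputable section

namespace LotteryBlotto

/-! Two players A and B with budgets `XA`, `XB` compete on `n` battlefields, indexed by `Fin n`.
Battlefield `i` is worth `wA i` to A and `wB i` to B. -/

variable {n : ℕ}

/-- The total value `W_P = ∑ j, w j` that a player assigns to the battlefields. -/
def total (w : Fin n → ℝ) : ℝ := ∑ j, w j

/-- The normalized value `v_i = w_i / W_P`. -/
def normVal (w : Fin n → ℝ) (i : Fin n) : ℝ := w i / total w

/-- Assumption (A0) with the bounds `wlo` and `whi`. -/
def AssumptionA0 (wlo whi : ℝ) (wA wB : Fin n → ℝ) : Prop :=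
  ∀ i, wA i ∈ Set.Icc wlo whi ∧ wB i ∈ Set.Icc wlo whi

/-! ### The Generalized Lottery Blotto game -/

/-- The pure strategies of a player with budget `X`. -/
def pureStrategies (n : ℕ) (X : ℝ) : Set (Fin n → ℝ) :=
  {x | (∀ i, 0 ≤ x i) ∧ ∑ i, x i ≤ X}

/-- The mixed strategies of a player with budget `X`: the (Borel) probability distributions on
allocation vectors that are concentrated on the pure strategies. -/
def mixedStrategies (n : ℕ) (X : ℝ) : Set (Measure (Fin n → ℝ)) :=
  {s | IsProbabilityMeasure s ∧ ∀ᵐ x ∂s, x ∈ pureStrategies n X}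

/-- A pair of functions `(ζ_A, ζ_B)` of the two allocations (first that of A, then that of B)
to a battlefield, giving the winning probabilities of A and of B. -/
structure CSFPair where
  /-- The probability that A wins. -/
  A : ℝ → ℝ → ℝ
  /-- The probability that B wins. -/
  B : ℝ → ℝ → ℝ

/-- The power form contest success functions `μ^R` with tie parameter `α`. -/
def powerCSF (α R : ℝ) : CSFPair where
  A x y := if x = 0 ∧ y = 0 then α else α * x ^ R / (α * x ^ R + (1 - α) * y ^ R)
  B x y := if x = 0 ∧ y = 0 then 1 - α else (1 - α) * y ^ R / (α * x ^ R + (1 - α) * y ^ R)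

/-- The logit form contest success functions `ν^R` with tie parameter `α`
(at `x = y = 0` the formulas give `α` and `1 - α`). -/
def logitCSF (α R : ℝ) : CSFPair where
  A x y := α * Real.exp (x * R) / (α * Real.exp (x * R) + (1 - α) * Real.exp (y * R))
  B x y := (1 - α) * Real.exp (y * R) / (α * Real.exp (x * R) + (1 - α) * Real.exp (y * R))

/-- The payoff of A at a profile of pure strategies. -/
def purePayoffA (ζ : CSFPair) (wA : Fin n → ℝ) (x y : Fin n → ℝ) : ℝ :=
  ∑ i, wA i * ζ.A (x i) (y i)

/-- The payoff of B at a profile of pure strategies. -/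
def purePayoffB (ζ : CSFPair) (wB : Fin n → ℝ) (x y : Fin n → ℝ) : ℝ :=
  ∑ i, wB i * ζ.B (x i) (y i)

/-- The (expected) payoff of A at a profile of mixed strategies. -/
def payoffA (ζ : CSFPair) (wA : Fin n → ℝ) (s t : Measure (Fin n → ℝ)) : ℝ :=
  ∫ p, purePayoffA ζ wA p.1 p.2 ∂(s.prod t)

/-- The (expected) payoff of B at a profile of mixed strategies. -/
def payoffB (ζ : CSFPair) (wB : Fin n → ℝ) (s t : Measure (Fin n → ℝ)) : ℝ :=
  ∫ p, purePayoffB ζ wB p.1 p.2 ∂(s.prod t)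

/-- `(s, t)` is an `ε`-equilibrium of the Generalized Lottery Blotto game with contest success
functions `ζ`, budgets `XA`, `XB` and values `wA`, `wB`. -/
def IsApproxEquilibrium (ζ : CSFPair) (XA XB : ℝ) (wA wB : Fin n → ℝ) (ε : ℝ)
    (s t : Measure (Fin n → ℝ)) : Prop :=
  s ∈ mixedStrategies n XA ∧ t ∈ mixedStrategies n XB ∧
    (∀ s' ∈ mixedStrategies n XA, payoffA ζ wA s' t ≤ payoffA ζ wA s t + ε) ∧
    (∀ t' ∈ mixedStrategies n XB, payoffB ζ wB s t' ≤ payoffB ζ wB s t + ε)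

/-! ### The independently uniform strategies -/

/-- `Ω_A(γ)`: the battlefields with `v^A_i / v^B_i > γ`. -/
def omegaA (wA wB : Fin n → ℝ) (γ : ℝ) : Finset (Fin n) :=
  Finset.univ.filter fun i => normVal wA i / normVal wB i > γ

/-- The set of the positive solutions `γ` of the equation
`X_B γ / X_A = (γ² ∑_{Ω_A(γ)} (v^B)²/v^A + ∑_{Ω_A(γ)ᶜ} v^A) /
(∑_{Ω_A(γ)} v^B + γ⁻² ∑_{Ω_A(γ)ᶜ} (v^A)²/v^B)`. -/
def gammaSolutions (XA XB : ℝ) (wA wB : Fin n → ℝ) : Set ℝ :=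
  {γ | 0 < γ ∧ XB * γ / XA =
    (γ ^ 2 * ∑ i ∈ omegaA wA wB γ, normVal wB i ^ 2 / normVal wA i
        + ∑ i ∈ (omegaA wA wB γ)ᶜ, normVal wA i) /
      (∑ i ∈ omegaA wA wB γ, normVal wB i
        + 1 / γ ^ 2 * ∑ i ∈ (omegaA wA wB γ)ᶜ, normVal wA i ^ 2 / normVal wB i)}

/-- The constant `λ*_A` that corresponds to a solution `γ`. -/
def lambdaA (XB : ℝ) (wA wB : Fin n → ℝ) (γ : ℝ) : ℝ :=
  γ ^ 2 / (2 * XB) * ∑ i ∈ omegaA wA wB γ, normVal wB i ^ 2 / normVal wA i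
    + 1 / (2 * XB) * ∑ i ∈ (omegaA wA wB γ)ᶜ, normVal wA i

/-- The constant `λ*_B` that corresponds to a solution `γ`. -/
def lambdaB (XA : ℝ) (wA wB : Fin n → ℝ) (γ : ℝ) : ℝ :=
  1 / (2 * XA) * ∑ i ∈ omegaA wA wB γ, normVal wB i
    + 1 / (2 * γ ^ 2 * XA) * ∑ i ∈ (omegaA wA wB γ)ᶜ, normVal wA i ^ 2 / normVal wB i

/-- The uniform distribution on `[0, b]`; its distribution function is `x / b` on `[0, b]`. -/
def strongDist (b : ℝ) : Measure ℝ :=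
  ENNReal.ofReal (1 / b) • volume.restrict (Set.Icc 0 b)

/-- The distribution with mass `(a - b) / a` at `0` whose remaining mass is uniform on `(0, b]`
(`0 < b ≤ a`); its distribution function is `(a - b) / a + x / a` on `[0, b]`. -/
def weakDist (a b : ℝ) : Measure ℝ :=
  ENNReal.ofReal ((a - b) / a) • Measure.dirac 0
    + ENNReal.ofReal (1 / a) • volume.restrict (Set.Ioc 0 b)

/-- The uniform-type distribution of `A*_i`. -/
def distA (XA XB : ℝ) (wA wB : Fin n → ℝ) (γ : ℝ) (i : Fin n) : Measure ℝ :=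
  if i ∈ omegaA wA wB γ then strongDist (normVal wB i / lambdaB XA wA wB γ)
  else weakDist (normVal wB i / lambdaB XA wA wB γ) (normVal wA i / lambdaA XB wA wB γ)

/-- The uniform-type distribution of `B*_i`. -/
def distB (XA XB : ℝ) (wA wB : Fin n → ℝ) (γ : ℝ) (i : Fin n) : Measure ℝ :=
  if i ∈ omegaA wA wB γ then
    weakDist (normVal wA i / lambdaA XB wA wB γ) (normVal wB i / lambdaB XA wA wB γ)
  else strongDist (normVal wA i / lambdaA XB wA wB γ)

/-- Rescaling of the drawn numbers `a` so that they spend the budget `X`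
(the zero allocation if their sum is `0`). -/
def rescale (X : ℝ) (a : Fin n → ℝ) : Fin n → ℝ :=
  if ∑ j, a j = 0 then 0 else fun i => a i / (∑ j, a j) * X

/-- The independently uniform strategy of A: draw `a_i` from the distribution of `A*_i`,
independently over `i`, and rescale. -/
def iuA (XA XB : ℝ) (wA wB : Fin n → ℝ) (γ : ℝ) : Measure (Fin n → ℝ) :=
  (Measure.pi (distA XA XB wA wB γ)).map (rescale XA)

/-- The independently uniform strategy of B: draw `b_i` from the distribution of `B*_i`,
independently over `i`, and rescale. -/
def iuB (XA XB : ℝ) (wA wB : Fin n → ℝ) (γ : ℝ) : Measure (Fin n → ℝ) :=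
  (Measure.pi (distB XA XB wA wB γ)).map (rescale XB)

end LotteryBlotto

end

/-! Write `p i = v^A_i / λ_A`, `q i = v^B_i / λ_B` and `h i = min (p i) (q i)`. The equation for `γ`
amounts to `λ_A = γ λ_B`, so `i ∈ Ω_A(γ)` exactly when `q i < p i`. Hence A draws from `weakDist (q
i) (h i)` and B from `weakDist (p i) (h i)`, and the definitions of the two `λ` say that the draws
spend each budget in expectation.

The equilibrium property comes from a linear distribution function. An amount `z ≥ 0` beats B's draw
on battlefield `i` with probability at most `(p i - h i) / p i + z / p i`, with equality for `z ≤ h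
i`. Since `v^A_i = λ_A p i`, the weighted sum of these bounds is `λ_A (∑ (p i - h i) + ∑ z i)`,
which depends on an allocation only through what it spends. So no strategy of A gets more than `λ_A
(∑ (p i - h i) + X_A)`, up to errors. A's own draws stay in `[0, h i]`, where the bound is an
equality, and spend `X_A` on average, so they reach this value up to errors
(`IsSharp.expectedValue_le`, `IsSharp.le_expectedValue`). The case of B follows by exchanging the
players and replacing `α` by `1 - α`.

There are two sources of error. Rescaling changes each draw by a factor close to one: every draw is
at most `K / n`, so by Hoeffding the sum is within a factor `1 ± θ` of the budget except with
probability exponentially small in `θ² n`. The contest success function is not a step function, but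
outside a margin `δ` it is within `η` of one (`IsSharp`). The margin costs a multiple of `n δ` in
total. The choice `θ ∼ ε`, `δ ∼ ε / n`, `η = ε / 8` leads to the conditions on `n` and `R`. -/

namespace LotteryBlotto

/-! ### The distributions on a single battlefield -/

section WeakDist

variable {a b : ℝ}

/-- The atom vanishes when the parameters agree, so the one family `weakDist` covers both players on
every battlefield. -/
lemma strongDist_eq_weakDist (b : ℝ) : strongDist b = weakDist b b := by
  simp [strongDist, weakDist, Measure.restrict_congr_set Ioc_ae_eq_Icc]

lemma weakDist_real_apply (hb : 0 < b) (hab : b ≤ a) (s : Set ℝ) (hs : MeasurableSet s) :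
    (weakDist a b).real s =
      (a - b) / a * s.indicator 1 0 + 1 / a * volume.real (s ∩ Set.Ioc 0 b) := by
  have ha : 0 < a := hb.trans_le hab
  have hfin : volume (s ∩ Set.Ioc 0 b) ≠ ⊤ :=
    measure_ne_top_of_subset Set.inter_subset_right (by simp)
  rw [weakDist, measureReal_add_apply (by
      simp only [Measure.smul_apply, smul_eq_mul]
      exact ENNReal.mul_ne_top ENNReal.ofReal_ne_top (measure_ne_top _ _)) (by
      simp only [Measure.smul_apply, smul_eq_mul, Measure.restrict_apply hs]
      exact ENNReal.mul_ne_top ENNReal.ofReal_ne_top hfin),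
    measureReal_ennreal_smul_apply, measureReal_ennreal_smul_apply,
    ENNReal.toReal_ofReal (div_nonneg (sub_nonneg.2 hab) ha.le),
    ENNReal.toReal_ofReal (by positivity), measureReal_restrict_apply hs]
  congr 2
  rw [measureReal_def, Measure.dirac_apply' _ hs]
  by_cases h : (0 : ℝ) ∈ s <;> simp [h]

lemma isProbabilityMeasure_weakDist (hb : 0 < b) (hab : b ≤ a) :
    IsProbabilityMeasure (weakDist a b) := by
  have ha : 0 < a := hb.trans_le hab
  constructor
  simp only [weakDist, Measure.add_apply, Measure.smul_apply, measure_univ, smul_eq_mul, mul_one,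
    Measure.restrict_apply_univ, Real.volume_Ioc, sub_zero]
  rw [← ENNReal.ofReal_mul (by positivity),
    ← ENNReal.ofReal_add (div_nonneg (sub_nonneg.2 hab) ha.le) (by positivity),
    ENNReal.ofReal_eq_one]
  field_simp
  ring

lemma ae_weakDist (a : ℝ) (hb : 0 < b) : ∀ᵐ x ∂(weakDist a b), x ∈ Set.Icc 0 b := by
  rw [weakDist, ae_add_measure_iff]
  refine ⟨Measure.ae_smul_measure ?_ _, Measure.ae_smul_measure ?_ _⟩
  · exact (ae_dirac_iff measurableSet_Icc).2 ⟨le_rfl, hb.le⟩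
  · filter_upwards [ae_restrict_mem measurableSet_Ioc] with x hx
    exact Set.Ioc_subset_Icc_self hx

lemma integral_id_weakDist (hb : 0 < b) (hab : b ≤ a) :
    ∫ x, x ∂(weakDist a b) = b ^ 2 / (2 * a) := by
  have ha : 0 < a := hb.trans_le hab
  rw [weakDist, integral_add_measure, integral_smul_measure, integral_smul_measure,
    integral_dirac, ← intervalIntegral.integral_of_le hb.le, integral_id,
    ENNReal.toReal_ofReal (one_div_nonneg.2 ha.le)]
  · simp only [smul_eq_mul]
    field_simp
    ring
  · exact (integrable_dirac (by simp)).smul_measure ENNReal.ofReal_ne_top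
  · refine Integrable.smul_measure ?_ ENNReal.ofReal_ne_top
    exact (continuous_id.integrableOn_Icc (a := 0) (b := b)).mono_set Set.Ioc_subset_Icc_self

lemma weakDist_real_Iic (hb : 0 < b) (hab : b ≤ a) {z : ℝ} (hz : 0 ≤ z) (hzb : z ≤ b) :
    (weakDist a b).real (Set.Iic z) = (a - b) / a + z / a := by
  rw [weakDist_real_apply hb hab _ measurableSet_Iic, Set.inter_comm, Set.Ioc_inter_Iic]
  simp [hz, hzb]
  ring

/-- Beyond `b` the distribution function stays at one while the line keeps growing. An arbitrary
deviation needs this one-sided form, with no upper limit on `z`. -/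
lemma weakDist_real_Iic_le (hb : 0 < b) (hab : b ≤ a) {z : ℝ} (hz : 0 ≤ z) :
    (weakDist a b).real (Set.Iic z) ≤ (a - b) / a + z / a := by
  have ha : 0 < a := hb.trans_le hab
  rw [weakDist_real_apply hb hab _ measurableSet_Iic, Set.inter_comm, Set.Ioc_inter_Iic,
    Real.volume_real_Ioc_of_le (le_min hb.le hz)]
  have : (Set.Iic z).indicator (1 : ℝ → ℝ) 0 = 1 := by simp [hz]
  rw [this, mul_one, sub_zero, div_eq_mul_one_div z, mul_comm z]
  gcongr
  exact min_le_right _ _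

lemma weakDist_real_Ioo_le (hb : 0 < b) (hab : b ≤ a) {d : ℝ} (hd : 0 ≤ d) :
    (weakDist a b).real (Set.Ioo 0 d) ≤ d / a := by
  have ha : 0 < a := hb.trans_le hab
  rw [weakDist_real_apply hb hab _ measurableSet_Ioo]
  have : (Set.Ioo 0 d).indicator (1 : ℝ → ℝ) 0 = 0 := by simp
  rw [this, mul_zero, zero_add, div_eq_mul_one_div d, mul_comm d]
  gcongr
  calc volume.real (Set.Ioo 0 d ∩ Set.Ioc 0 b) ≤ volume.real (Set.Ioo 0 d) :=
        measureReal_mono Set.inter_subset_left (by simp)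
    _ = d := by simp [hd]

end WeakDist

/-! ### Concentration of the total draw -/

section Concentration

open ProbabilityTheory

variable {n : ℕ} {μ : Fin n → Measure ℝ} [∀ i, IsProbabilityMeasure (μ i)]

lemma ae_pi_eval {s : Fin n → Set ℝ} (h : ∀ i, ∀ᵐ x ∂(μ i), x ∈ s i) :
    ∀ᵐ x ∂(Measure.pi μ), ∀ i, x i ∈ s i :=
  ae_all_iff.2 fun i => (measurePreserving_eval μ i).quasiMeasurePreserving.ae (h i)

/-- Hoeffding's inequality for the upper tail of a sum of independent coordinates. -/
lemma pi_real_sum_ge_le {K : ℝ} (hn : 0 < n) (hK : 0 < K)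
    (h : ∀ i, ∀ᵐ x ∂(μ i), x ∈ Set.Icc 0 (K / n)) {t : ℝ} (ht : 0 ≤ t) :
    (Measure.pi μ).real {x | (∑ i, ∫ y, y ∂(μ i)) + t ≤ ∑ i, x i}
      ≤ Real.exp (-(2 * t ^ 2 * n / K ^ 2)) := by
  -- A variable in an interval of length `K / n` has variance proxy `(K / (2 n))²`. The `n` proxies
  -- add up to `K² / (4 n)`, which gives the exponent `2 t² n / K²`.
  have hsub : ∀ i ∈ Finset.univ, HasSubgaussianMGF (fun x : Fin n → ℝ => x i - ∫ y, y ∂(μ i))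
      ((‖K / n - 0‖₊ / 2) ^ 2) (Measure.pi μ) := fun i _ => by
    have := hasSubgaussianMGF_of_mem_Icc (X := fun y : ℝ => y) aemeasurable_id (h i)
    exact HasSubgaussianMGF.of_map (Y := fun x : Fin n → ℝ => x i)
      (X := fun y : ℝ => y - ∫ y, y ∂(μ i)) (measurable_pi_apply i).aemeasurable
      (by rwa [(measurePreserving_eval μ i).map_eq])
  have hind : iIndepFun (fun i (x : Fin n → ℝ) => x i - ∫ y, y ∂(μ i)) (Measure.pi μ) :=
    iIndepFun_pi (X := fun i (y : ℝ) => y - ∫ y, y ∂(μ i)) fun i => by fun_prop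
  have key := HasSubgaussianMGF.measure_sum_ge_le_of_iIndepFun hind hsub ht
  have hn' : (0 : ℝ) < n := Nat.cast_pos.2 hn
  convert key using 2
  · ext x
    simp only [Finset.sum_sub_distrib, Set.mem_ofPred_eq]
    constructor <;> intro h <;> linarith
  · simp only [Finset.sum_const, Finset.card_univ, Fintype.card_fin, nsmul_eq_mul]
    push_cast
    rw [sub_zero, Real.norm_of_nonneg (by positivity)]
    field_simp

/-- Hoeffding's inequality for the lower tail of a sum of independent coordinates. -/
lemma pi_real_sum_le_le {K : ℝ} (hn : 0 < n) (hK : 0 < K)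
    (h : ∀ i, ∀ᵐ x ∂(μ i), x ∈ Set.Icc 0 (K / n)) {t : ℝ} (ht : 0 ≤ t) :
    (Measure.pi μ).real {x | ∑ i, x i ≤ (∑ i, ∫ y, y ∂(μ i)) - t}
      ≤ Real.exp (-(2 * t ^ 2 * n / K ^ 2)) := by
  have hsub : ∀ i ∈ Finset.univ, HasSubgaussianMGF (fun x : Fin n → ℝ => -(x i - ∫ y, y ∂(μ i)))
      ((‖K / n - 0‖₊ / 2) ^ 2) (Measure.pi μ) := fun i _ => by
    have := (hasSubgaussianMGF_of_mem_Icc (X := fun y : ℝ => y) aemeasurable_id (h i)).neg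
    exact HasSubgaussianMGF.of_map (Y := fun x : Fin n → ℝ => x i)
      (X := fun y : ℝ => -(y - ∫ y, y ∂(μ i))) (measurable_pi_apply i).aemeasurable
      (by rw [(measurePreserving_eval μ i).map_eq]; exact this)
  have hind : iIndepFun (fun i (x : Fin n → ℝ) => -(x i - ∫ y, y ∂(μ i))) (Measure.pi μ) :=
    iIndepFun_pi (X := fun i (y : ℝ) => -(y - ∫ y, y ∂(μ i))) fun i => by fun_prop
  have key := HasSubgaussianMGF.measure_sum_ge_le_of_iIndepFun hind hsub ht
  have hn' : (0 : ℝ) < n := Nat.cast_pos.2 hn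
  convert key using 2
  · ext x
    simp only [Finset.sum_neg_distrib, Finset.sum_sub_distrib, Set.mem_ofPred_eq]
    constructor <;> intro h <;> linarith
  · simp only [Finset.sum_const, Finset.card_univ, Fintype.card_fin, nsmul_eq_mul]
    push_cast
    rw [sub_zero, Real.norm_of_nonneg (by positivity)]
    field_simp

end Concentration

/-! ### Two independent draws on one battlefield -/

lemma ae_ne_zero_weakDist_self {q : ℝ} (hq : 0 < q) : ∀ᵐ x ∂(weakDist q q), x ≠ 0 := by
  have := isProbabilityMeasure_weakDist hq le_rfl
  have h : (weakDist q q).real {0} = 0 := by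
    rw [weakDist_real_apply hq le_rfl _ (measurableSet_singleton 0)]
    have : ({0} : Set ℝ) ∩ Set.Ioc 0 q = ∅ := by
      ext x
      simp only [Set.mem_inter_iff, Set.mem_singleton_iff, Set.mem_Ioc, Set.mem_empty_iff_false]
      grind
    simp [this]
  rw [ae_iff]
  simpa [measureReal_eq_zero_iff] using h

/-- If `a` and `b` are drawn from the two distributions of a battlefield, then `a` beats `b` by
the margin `d` about as often as `a` beats `b`. -/
lemma le_prod_weakDist_real {p q h d : ℝ} (hh : 0 < h) (hp : h ≤ p) (hq : h ≤ q)
    (hpq : h = p ∨ h = q) (hd : 0 ≤ d) :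
    (p - h) / p + h ^ 2 / (2 * q) / p - d / p - d / q ≤
      ((weakDist q h).prod (weakDist p h)).real {z | z.2 + d ≤ z.1} := by
  have hp0 : 0 < p := hh.trans_le hp
  have hq0 : 0 < q := hh.trans_le hq
  have := isProbabilityMeasure_weakDist hh hp
  have := isProbabilityMeasure_weakDist hh hq
  have hs : MeasurableSet {z : ℝ × ℝ | z.2 + d ≤ z.1} :=
    measurableSet_le (by fun_prop) (by fun_prop)
  have hint : Integrable ({z : ℝ × ℝ | z.2 + d ≤ z.1}.indicator (1 : ℝ × ℝ → ℝ))
      ((weakDist q h).prod (weakDist p h)) := (integrable_const 1).indicator hs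
  rw [← integral_indicator_one hs, integral_prod _ hint]
  have hinner : ∀ a, ∫ b, {z : ℝ × ℝ | z.2 + d ≤ z.1}.indicator 1 (a, b) ∂(weakDist p h)
      = (weakDist p h).real (Set.Iic (a - d)) := fun a => by
    rw [← integral_indicator_one measurableSet_Iic]
    congr 1 with b
    simp only [Set.indicator_apply, Set.mem_ofPred_eq, Set.mem_Iic, le_sub_iff_add_le]
    rfl
  have hid : Integrable (fun a : ℝ => a) (weakDist q h) :=
    Integrable.of_mem_Icc 0 h aemeasurable_id (ae_weakDist q hh)
  have hind : Integrable ((Set.Ioo 0 d).indicator (1 : ℝ → ℝ)) (weakDist q h) :=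
    (integrable_const 1).indicator measurableSet_Ioo
  have hlin : Integrable (fun a : ℝ => (p - h) / p - d / p + a / p) (weakDist q h) :=
    (integrable_const _).add (hid.div_const p)
  -- The comparison integrand is the linear distribution function shifted by `d`. Subtracting the
  -- indicator makes it nonpositive on `(0, d)`, where the shifted argument is negative; this costs
  -- at most `d / q`.
  have hlow : (p - h) / p + h ^ 2 / (2 * q) / p - d / p - d / q ≤
      ∫ a, ((p - h) / p - d / p + a / p - (Set.Ioo 0 d).indicator (1 : ℝ → ℝ) a)
        ∂(weakDist q h) := by
    rw [integral_sub hlin hind,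
      integral_add (integrable_const _) (hid.div_const p), integral_indicator_one measurableSet_Ioo,
      integral_div, integral_id_weakDist hh hq]
    simp only [integral_const, probReal_univ, smul_eq_mul, one_mul]
    linarith [weakDist_real_Ioo_le hh hq hd]
  refine hlow.trans (integral_mono_ae (hlin.sub hind)
    hint.integral_prod_left ?_)
  -- Ties at `0` are harmless because only one of the two draws can have an atom there: either `h =
  -- q` and the first has none, or `h = p` and the term `(p - h) / p` vanishes.
  have hzero : ∀ᵐ a ∂(weakDist q h), a ≠ 0 ∨ h = p := by
    rcases hpq with rfl | rfl
    · exact .of_forall fun _ => .inr rfl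
    · exact (ae_ne_zero_weakDist_self hh).mono fun _ => .inl
  filter_upwards [ae_weakDist q hh, hzero] with a ⟨ha0, hah⟩ ha
  simp only [hinner]
  rcases le_or_gt d a with hda | hda
  · rw [weakDist_real_Iic hh hp (sub_nonneg.2 hda) (by linarith)]
    have : 0 ≤ (Set.Ioo 0 d).indicator (1 : ℝ → ℝ) a :=
      Set.indicator_nonneg (fun _ _ => zero_le_one) _
    rw [sub_div a]
    linarith
  · refine le_trans ?_ measureReal_nonneg
    have hdp : 0 ≤ d / p := by positivity
    rcases eq_or_lt_of_le ha0 with rfl | ha0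
    · have : h = p := by simpa using ha
      simp [this, hdp]
    · have h1 : (Set.Ioo 0 d).indicator (1 : ℝ → ℝ) a = 1 := by simp [ha0, hda]
      have h2 : (p - h) / p + a / p ≤ 1 := by
        rw [← add_div, div_le_one hp0]
        linarith
      linarith

/-- Up to `η`, the contest success function `f` is decided by allocations in `[0, M]` that differ
by at least `δ`. -/
structure IsSharp (f : ℝ → ℝ → ℝ) (M δ η : ℝ) : Prop where
  measurable : Measurable (Function.uncurry f)
  mem_Icc : ∀ x ∈ Set.Icc 0 M, ∀ y ∈ Set.Icc 0 M, f x y ∈ Set.Icc 0 1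
  le_of_add_le : ∀ x ∈ Set.Icc 0 M, ∀ y ∈ Set.Icc 0 M, x + δ ≤ y → f x y ≤ η
  ge_of_add_le : ∀ x ∈ Set.Icc 0 M, ∀ y ∈ Set.Icc 0 M, y + δ ≤ x → 1 - η ≤ f x y

/-! ### Rescaling the draws to the budget -/

variable {n : ℕ}

lemma measurable_rescale (X : ℝ) : Measurable (rescale X : (Fin n → ℝ) → Fin n → ℝ) := by
  unfold rescale
  refine Measurable.ite (measurableSet_eq_fun (by fun_prop) (by fun_prop)) (by fun_prop) ?_
  exact measurable_pi_lambda _ fun i => by fun_prop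

lemma rescale_mem_pureStrategies {X : ℝ} (hX : 0 ≤ X) {a : Fin n → ℝ} (ha : ∀ i, 0 ≤ a i) :
    rescale X a ∈ pureStrategies n X := by
  unfold rescale
  split_ifs with h
  · exact ⟨fun _ => le_rfl, by simpa using hX⟩
  · have hS : 0 ≤ ∑ j, a j := Finset.sum_nonneg fun i _ => ha i
    refine ⟨fun i => mul_nonneg (div_nonneg (ha i) hS) hX, ?_⟩
    rw [← Finset.sum_mul, ← Finset.sum_div, div_self h, one_mul]

lemma mem_Icc_of_mem_pureStrategies {X M : ℝ} (hXM : X ≤ M) {x : Fin n → ℝ}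
    (hx : x ∈ pureStrategies n X) (i : Fin n) : x i ∈ Set.Icc 0 M :=
  ⟨hx.1 i, ((Finset.single_le_sum (fun j _ => hx.1 j) (Finset.mem_univ i)).trans hx.2).trans hXM⟩

lemma rescale_apply {X : ℝ} {a : Fin n → ℝ} (h : ∑ j, a j ≠ 0) (i : Fin n) :
    rescale X a i = a i / (∑ j, a j) * X := by
  simp [rescale, h]

section Pointwise

variable {f : ℝ → ℝ → ℝ} {X Y M δ η θ : ℝ}

/-- The success probability of `x` against a rescaled draw `b`. -/
lemma IsSharp.le_of_rescale (hf : IsSharp f M δ η) (hδ : 0 < δ) (hη : 0 ≤ η) (hXM : X ≤ M)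
    (hY : 0 < Y) (hYM : Y ≤ M) {x b : Fin n → ℝ} (hx : x ∈ pureStrategies n X)
    (hb : ∀ i, 0 ≤ b i) (i : Fin n) :
    f (x i) (rescale Y b i) ≤ η + (Set.Iic ((x i + δ) * (1 + θ))).indicator 1 (b i)
      + {b : Fin n → ℝ | Y + θ * Y ≤ ∑ j, b j}.indicator 1 b := by
  have hxi := mem_Icc_of_mem_pureStrategies hXM hx i
  have hyi := mem_Icc_of_mem_pureStrategies hYM (rescale_mem_pureStrategies hY.le hb) i
  have h1 := (hf.mem_Icc _ hxi _ hyi).2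
  have hn1 : (0 : ℝ) ≤ (Set.Iic ((x i + δ) * (1 + θ))).indicator 1 (b i) :=
    Set.indicator_nonneg (fun _ _ => zero_le_one) _
  have hn2 : (0 : ℝ) ≤ {b : Fin n → ℝ | Y + θ * Y ≤ ∑ j, b j}.indicator 1 b :=
    Set.indicator_nonneg (fun _ _ => zero_le_one) _
  by_cases hbad : Y + θ * Y ≤ ∑ j, b j
  · rw [Set.indicator_of_mem (s := {b : Fin n → ℝ | Y + θ * Y ≤ ∑ j, b j}) hbad, Pi.one_apply]
    linarith
  by_cases hlow : b i ≤ (x i + δ) * (1 + θ)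
  · rw [Set.indicator_of_mem (Set.mem_Iic.2 hlow), Pi.one_apply]
    linarith
  refine (hf.le_of_add_le _ hxi _ hyi ?_).trans (by linarith)
  push Not at hbad hlow
  have hxδ : 0 < x i + δ := by linarith [hxi.1]
  have hle : b i ≤ ∑ j, b j := Finset.single_le_sum (fun j _ => hb j) (Finset.mem_univ i)
  have hS : 0 ≤ ∑ j, b j := Finset.sum_nonneg fun j _ => hb j
  -- The default value of `rescale` at sum zero must be excluded: the draw `b i` exceeds a positive
  -- number here.
  have hSpos : 0 < ∑ j, b j := by
    rcases hS.eq_or_lt with h | h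
    · have : 0 < 1 + θ := by
        have : 0 < Y * (1 + θ) := by linarith
        exact pos_of_mul_pos_right this hY.le
      nlinarith
    · exact h
  rw [rescale_apply hSpos.ne', div_mul_eq_mul_div, le_div_iff₀ hSpos]
  calc (x i + δ) * ∑ j, b j ≤ (x i + δ) * (Y + θ * Y) := by gcongr
    _ = (x i + δ) * (1 + θ) * Y := by ring
    _ ≤ b i * Y := by gcongr

/-- The success probability of a rescaled draw `a` against a rescaled draw `b`. -/
lemma IsSharp.ge_of_rescale (hf : IsSharp f M δ η) (hδ : 0 < δ) (hη : 0 ≤ η) (hX : 0 < X)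
    (hXM : X ≤ M) (hY : 0 < Y) (hYM : Y ≤ M) (hθ : 0 < θ) (hθ1 : θ < 1) {κ : ℝ}
    {a b : Fin n → ℝ} (ha : ∀ i, a i ∈ Set.Icc 0 κ) (hb : ∀ i, 0 ≤ b i) (i : Fin n) :
    {z : ℝ × ℝ | z.2 + (2 * θ * κ + δ) ≤ z.1}.indicator 1 (a i, b i) - η
      - {a : Fin n → ℝ | X + θ * X ≤ ∑ j, a j}.indicator 1 a
      - {b : Fin n → ℝ | ∑ j, b j ≤ Y - θ * Y}.indicator 1 b
      ≤ f (rescale X a i) (rescale Y b i) := by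
  have ha0 : ∀ i, 0 ≤ a i := fun i => (ha i).1
  have hxi := mem_Icc_of_mem_pureStrategies hXM (rescale_mem_pureStrategies hX.le ha0) i
  have hyi := mem_Icc_of_mem_pureStrategies hYM (rescale_mem_pureStrategies hY.le hb) i
  have h0 := (hf.mem_Icc _ hxi _ hyi).1
  have hle1 : {z : ℝ × ℝ | z.2 + (2 * θ * κ + δ) ≤ z.1}.indicator (1 : ℝ × ℝ → ℝ) (a i, b i) ≤ 1 :=
    Set.indicator_le_self' (fun _ _ => zero_le_one) _
  have hn1 : (0 : ℝ) ≤ {a : Fin n → ℝ | X + θ * X ≤ ∑ j, a j}.indicator 1 a :=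
    Set.indicator_nonneg (fun _ _ => zero_le_one) _
  have hn2 : (0 : ℝ) ≤ {b : Fin n → ℝ | ∑ j, b j ≤ Y - θ * Y}.indicator 1 b :=
    Set.indicator_nonneg (fun _ _ => zero_le_one) _
  by_cases hbad : X + θ * X ≤ ∑ j, a j
  · rw [Set.indicator_of_mem (s := {a : Fin n → ℝ | X + θ * X ≤ ∑ j, a j}) hbad, Pi.one_apply]
    linarith
  by_cases hbad' : ∑ j, b j ≤ Y - θ * Y
  · rw [Set.indicator_of_mem (s := {b : Fin n → ℝ | ∑ j, b j ≤ Y - θ * Y}) hbad', Pi.one_apply]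
    linarith
  by_cases hlow : b i + (2 * θ * κ + δ) ≤ a i
  swap
  · rw [Set.indicator_of_notMem (s := {z : ℝ × ℝ | z.2 + (2 * θ * κ + δ) ≤ z.1}) hlow]
    linarith
  refine le_trans (by linarith) (hf.ge_of_add_le _ hxi _ hyi ?_)
  push Not at hbad hbad'
  have hbi := hb i
  obtain ⟨hai, haκ⟩ := ha i
  have hκ : 0 ≤ κ := hai.trans haκ
  have hθκ : 0 ≤ θ * κ := by positivity
  have haS : a i ≤ ∑ j, a j := Finset.single_le_sum (fun j _ => ha0 j) (Finset.mem_univ i)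
  have hSa : 0 < ∑ j, a j := by linarith
  have hSb : 0 < ∑ j, b j := lt_trans (by nlinarith) hbad'
  rw [rescale_apply hSa.ne', rescale_apply hSb.ne']
  have h1 : a i / (1 + θ) ≤ a i / (∑ j, a j) * X := by
    rw [div_mul_eq_mul_div, div_le_div_iff₀ (by linarith) hSa]
    have := mul_le_mul_of_nonneg_left hbad.le hai
    linarith
  have h2 : b i / (∑ j, b j) * Y ≤ b i / (1 - θ) := by
    rw [div_mul_eq_mul_div, div_le_div_iff₀ hSb (by linarith)]
    have := mul_le_mul_of_nonneg_left hbad'.le hbi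
    linarith
  -- After clearing denominators the rescaling costs `θ (a i + b i) ≤ 2 θ κ`, which is exactly the
  -- extra margin in the hypothesis.
  have h3 : b i / (1 - θ) + δ ≤ a i / (1 + θ) := by
    rw [div_add' _ _ _ (by linarith), div_le_div_iff₀ (by linarith) (by linarith)]
    nlinarith [mul_nonneg hθ.le (sub_nonneg.2 haκ), mul_pos hδ (mul_pos hθ hθ),
      mul_nonneg hθ.le (show 0 ≤ κ - b i by linarith)]
  linarith

end Pointwise

/-- The expected value of the battlefields that the first player wins. -/
noncomputable def expectedValue (f : ℝ → ℝ → ℝ) (v : Fin n → ℝ) (s t : Measure (Fin n → ℝ)) : ℝ :=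
  ∫ z, ∑ i, v i * f (z.1 i) (z.2 i) ∂(s.prod t)

lemma map_rescale_mem_mixedStrategies {X : ℝ} (hX : 0 ≤ X) {μ : Measure (Fin n → ℝ)}
    [IsProbabilityMeasure μ] (hμ : ∀ᵐ a ∂μ, ∀ i, 0 ≤ a i) :
    μ.map (rescale X) ∈ mixedStrategies n X := by
  refine ⟨Measure.isProbabilityMeasure_map (measurable_rescale X).aemeasurable, ?_⟩
  have hmeas : MeasurableSet (pureStrategies n X) := by
    refine MeasurableSet.inter (s₁ := {x : Fin n → ℝ | ∀ i, 0 ≤ x i})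
      (s₂ := {x : Fin n → ℝ | ∑ i, x i ≤ X}) ?_ (measurableSet_le (by fun_prop) (by fun_prop))
    rw [Set.ofPred_forall]
    exact MeasurableSet.iInter fun i => measurableSet_le measurable_const (measurable_pi_apply i)
  refine (ae_map_iff (measurable_rescale X).aemeasurable hmeas).2 ?_
  exact hμ.mono fun a ha => rescale_mem_pureStrategies hX ha

/-! ### Value of the independently uniform strategies -/

section Value

variable {f : ℝ → ℝ → ℝ} {X Y M δ η θ : ℝ} {v : Fin n → ℝ}

lemma IsSharp.measurable_apply (hf : IsSharp f M δ η) {Ω : Type*} [MeasurableSpace Ω]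
    {x y : Ω → Fin n → ℝ} (hx : Measurable x) (hy : Measurable y) (i : Fin n) :
    Measurable fun ω => f (x ω i) (y ω i) :=
  hf.measurable.comp (((measurable_pi_apply i).comp hx).prodMk ((measurable_pi_apply i).comp hy))

lemma IsSharp.integrable_apply (hf : IsSharp f M δ η) {Ω : Type*} [MeasurableSpace Ω]
    {μ : Measure Ω} [IsFiniteMeasure μ] {x y : Ω → Fin n → ℝ} (hx : Measurable x)
    (hy : Measurable y) (hXM : X ≤ M) (hYM : Y ≤ M) (hxX : ∀ᵐ ω ∂μ, x ω ∈ pureStrategies n X)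
    (hyY : ∀ᵐ ω ∂μ, y ω ∈ pureStrategies n Y) (i : Fin n) :
    Integrable (fun ω => f (x ω i) (y ω i)) μ := by
  refine Integrable.of_mem_Icc 0 1 (hf.measurable_apply hx hy i).aemeasurable ?_
  filter_upwards [hxX, hyY] with ω h1 h2
  exact hf.mem_Icc _ (mem_Icc_of_mem_pureStrategies hXM h1 i) _
    (mem_Icc_of_mem_pureStrategies hYM h2 i)

lemma IsSharp.integrable_sum (hf : IsSharp f M δ η) {Ω : Type*} [MeasurableSpace Ω]
    {μ : Measure Ω} [IsFiniteMeasure μ] {x y : Ω → Fin n → ℝ} (hx : Measurable x)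
    (hy : Measurable y) (hXM : X ≤ M) (hYM : Y ≤ M) (hxX : ∀ᵐ ω ∂μ, x ω ∈ pureStrategies n X)
    (hyY : ∀ᵐ ω ∂μ, y ω ∈ pureStrategies n Y) :
    Integrable (fun ω => ∑ i, v i * f (x ω i) (y ω i)) μ :=
  integrable_finsetSum _ fun i _ => (hf.integrable_apply hx hy hXM hYM hxX hyY i).const_mul _

lemma ae_pi_weakDist_mem {p h : Fin n → ℝ} (hh : ∀ i, 0 < h i) (hp : ∀ i, h i ≤ p i) :
    ∀ᵐ b ∂(Measure.pi fun i => weakDist (p i) (h i)), ∀ i, b i ∈ Set.Icc 0 (h i) := by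
  have := fun i => isProbabilityMeasure_weakDist (hh i) (hp i)
  exact ae_pi_eval fun i => ae_weakDist (p i) (hh i)

/-- The three terms are the blur of `f`, the linear bound on the distribution function of the draw
`b i`, and the Hoeffding bound for a total draw above `(1 + θ) Y`. -/
lemma IsSharp.integral_rescale_le (hf : IsSharp f M δ η) (hδ : 0 < δ) (hη : 0 ≤ η)
    (hXM : X ≤ M) (hY : 0 < Y) (hYM : Y ≤ M) (hθ : 0 < θ) (hn : 0 < n) {K : ℝ} (hK : 0 < K)
    {p h : Fin n → ℝ} (hh : ∀ i, 0 < h i) (hp : ∀ i, h i ≤ p i) (hhK : ∀ i, h i ≤ K / n)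
    (hsum : ∑ i, h i ^ 2 / (2 * p i) = Y) {x : Fin n → ℝ} (hx : x ∈ pureStrategies n X)
    (i : Fin n) :
    ∫ b, f (x i) (rescale Y b i) ∂(Measure.pi fun i => weakDist (p i) (h i)) ≤
      η + ((p i - h i) / p i + (x i + δ) * (1 + θ) / p i)
        + Real.exp (-(2 * (θ * Y) ^ 2 * n / K ^ 2)) := by
  have := fun i => isProbabilityMeasure_weakDist (hh i) (hp i)
  set π := Measure.pi fun i => weakDist (p i) (h i)
  have hae := ae_pi_weakDist_mem hh hp
  have hm1 : MeasurableSet {b : Fin n → ℝ | b i ∈ Set.Iic ((x i + δ) * (1 + θ))} :=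
    measurableSet_Iic.preimage (measurable_pi_apply i)
  have hm2 : MeasurableSet {b : Fin n → ℝ | Y + θ * Y ≤ ∑ j, b j} :=
    measurableSet_le (by fun_prop) (by fun_prop)
  have hi1 : Integrable ({b : Fin n → ℝ | b i ∈ Set.Iic ((x i + δ) * (1 + θ))}.indicator
      (1 : (Fin n → ℝ) → ℝ)) π := (integrable_const 1).indicator hm1
  have hi2 : Integrable ({b : Fin n → ℝ | Y + θ * Y ≤ ∑ j, b j}.indicator
      (1 : (Fin n → ℝ) → ℝ)) π := (integrable_const 1).indicator hm2
  have hi3 : Integrable (fun b : Fin n → ℝ => η +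
      {b : Fin n → ℝ | b i ∈ Set.Iic ((x i + δ) * (1 + θ))}.indicator (1 : (Fin n → ℝ) → ℝ) b) π :=
    (integrable_const _).add hi1
  have hle : ∫ b, f (x i) (rescale Y b i) ∂π ≤ ∫ b, (η +
      {b : Fin n → ℝ | b i ∈ Set.Iic ((x i + δ) * (1 + θ))}.indicator (1 : (Fin n → ℝ) → ℝ) b
      + {b : Fin n → ℝ | Y + θ * Y ≤ ∑ j, b j}.indicator (1 : (Fin n → ℝ) → ℝ) b) ∂π := by
    refine integral_mono_ae (hf.integrable_apply (x := fun _ => x) measurable_const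
      (measurable_rescale Y) hXM hYM (.of_forall fun _ => hx) ?_ i) (hi3.add hi2) ?_
    · filter_upwards [hae] with b hb
      exact rescale_mem_pureStrategies hY.le fun j => (hb j).1
    · filter_upwards [hae] with b hb
      exact hf.le_of_rescale hδ hη hXM hY hYM hx (fun j => (hb j).1) i
  refine hle.trans ?_
  rw [integral_add hi3 hi2, integral_add (integrable_const _) hi1, integral_indicator_one hm1,
    integral_indicator_one hm2, integral_const, probReal_univ, one_smul]
  have h1 : π.real {b | b i ∈ Set.Iic ((x i + δ) * (1 + θ))} ≤
      (p i - h i) / p i + (x i + δ) * (1 + θ) / p i := by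
    have heval := (measurePreserving_eval (fun i => weakDist (p i) (h i)) i).measureReal_preimage
      (measurableSet_Iic (a := (x i + δ) * (1 + θ))).nullMeasurableSet
    refine (heval.trans_le (weakDist_real_Iic_le (hh i) (hp i) ?_))
    have := hx.1 i
    positivity
  have h2 : π.real {b | Y + θ * Y ≤ ∑ j, b j} ≤ Real.exp (-(2 * (θ * Y) ^ 2 * n / K ^ 2)) := by
    have := pi_real_sum_ge_le (μ := fun i => weakDist (p i) (h i)) hn hK
      (fun i => (ae_weakDist (p i) (hh i)).mono fun y hy => ⟨hy.1, hy.2.trans (hhK i)⟩)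
      (mul_nonneg hθ.le hY.le)
    simpa only [integral_id_weakDist (hh _) (hp _), hsum] using this
  linarith

/-- The value that any strategy obtains against an independently uniform strategy. -/
lemma IsSharp.expectedValue_le (hf : IsSharp f M δ η) (hδ : 0 < δ) (hη : 0 ≤ η)
    (hXM : X ≤ M) (hY : 0 < Y) (hYM : Y ≤ M) (hθ : 0 < θ) (hn : 0 < n) {K : ℝ} (hK : 0 < K)
    {p h : Fin n → ℝ} (hh : ∀ i, 0 < h i) (hp : ∀ i, h i ≤ p i) (hhK : ∀ i, h i ≤ K / n)
    (hsum : ∑ i, h i ^ 2 / (2 * p i) = Y) {l : ℝ} (hl : 0 < l) (hv : ∀ i, v i = l * p i)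
    (hv1 : ∑ i, v i = 1) {s : Measure (Fin n → ℝ)} (hs : s ∈ mixedStrategies n X) :
    expectedValue f v s ((Measure.pi fun i => weakDist (p i) (h i)).map (rescale Y)) ≤
      l * (∑ i, (p i - h i) + X) + (η + Real.exp (-(2 * (θ * Y) ^ 2 * n / K ^ 2))
        + l * (θ * X + (1 + θ) * (n * δ))) := by
  have := fun i => isProbabilityMeasure_weakDist (hh i) (hp i)
  set π := Measure.pi fun i => weakDist (p i) (h i) with hπ
  have hae : ∀ᵐ b ∂π, ∀ i, 0 ≤ b i :=
    (ae_pi_weakDist_mem hh hp).mono fun b hb i => (hb i).1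
  obtain ⟨_, htY⟩ := map_rescale_mem_mixedStrategies hY.le hae
  obtain ⟨_, hsX⟩ := hs
  set t := π.map (rescale Y)
  have hint : Integrable (fun z : (Fin n → ℝ) × (Fin n → ℝ) =>
      ∑ i, v i * f (z.1 i) (z.2 i)) (s.prod t) :=
    hf.integrable_sum measurable_fst measurable_snd hXM hYM
      (Measure.quasiMeasurePreserving_fst.ae hsX) (Measure.quasiMeasurePreserving_snd.ae htY)
  rw [expectedValue, integral_prod _ hint]
  set U := l * (∑ i, (p i - h i) + X) + (η + Real.exp (-(2 * (θ * Y) ^ 2 * n / K ^ 2))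
        + l * (θ * X + (1 + θ) * (n * δ))) with hU
  have hbound : ∀ᵐ x ∂s, ∫ y, ∑ i, v i * f (x i) (y i) ∂t ≤ U := by
    filter_upwards [hsX] with x hx
    have hmeas : Measurable fun y : Fin n → ℝ => ∑ i, v i * f (x i) (y i) :=
      Finset.measurable_fun_sum _ fun i _ =>
        (hf.measurable_apply (x := fun _ => x) measurable_const measurable_id i).const_mul _
    rw [integral_map (measurable_rescale Y).aemeasurable hmeas.aestronglyMeasurable,
      integral_finsetSum]
    swap
    · intro i _
      refine (hf.integrable_apply (x := fun _ => x) measurable_const (measurable_rescale Y) hXM hYM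
        (.of_forall fun _ => hx) ?_ i).const_mul _
      exact hae.mono fun b hb => rescale_mem_pureStrategies hY.le hb
    calc ∑ i, ∫ b, v i * f (x i) (rescale Y b i) ∂π
        ≤ ∑ i, ((η + Real.exp (-(2 * (θ * Y) ^ 2 * n / K ^ 2))) * v i
          + l * (p i - h i) + l * (1 + θ) * x i + l * (1 + θ) * δ) := by
          refine Finset.sum_le_sum fun i _ => ?_
          have hpi : 0 < p i := (hh i).trans_le (hp i)
          rw [integral_const_mul]
          have := hf.integral_rescale_le hδ hη hXM hY hYM hθ hn hK hh hp hhK hsum hx i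
          have hvi : 0 ≤ v i := by
            rw [hv i]
            positivity
          refine (mul_le_mul_of_nonneg_left this hvi).trans_eq ?_
          -- The factor `p i` in `v i = l * p i` cancels the slope `1 / p i`, so that every
          -- battlefield has the same marginal value `l (1 + θ)`.
          rw [hv i]
          field_simp
          ring
      _ = (η + Real.exp (-(2 * (θ * Y) ^ 2 * n / K ^ 2))) + l * ∑ i, (p i - h i)
          + l * (1 + θ) * ∑ i, x i + l * (1 + θ) * (n * δ) := by
          simp only [Finset.sum_add_distrib, ← Finset.mul_sum, hv1, Finset.sum_const,
            Finset.card_univ, Fintype.card_fin, nsmul_eq_mul]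
          ring
      _ ≤ U := by
          have : l * (1 + θ) * ∑ i, x i ≤ l * (1 + θ) * X := by
            gcongr
            exact hx.2
          rw [hU]
          linarith
  calc ∫ x, ∫ y, ∑ i, v i * f (x i) (y i) ∂t ∂s ≤ ∫ _, U ∂s :=
        integral_mono_ae hint.integral_prod_left (integrable_const U) hbound
    _ = U := by simp

/-- The value that an independently uniform strategy obtains against the other one. -/
lemma IsSharp.le_expectedValue (hf : IsSharp f M δ η) (hδ : 0 < δ) (hη : 0 ≤ η)
    (hX : 0 < X) (hXM : X ≤ M) (hY : 0 < Y) (hYM : Y ≤ M) (hθ : 0 < θ) (hθ1 : θ < 1)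
    (hn : 0 < n) {K : ℝ} (hK : 0 < K)
    {p q h : Fin n → ℝ} (hh : ∀ i, 0 < h i) (hp : ∀ i, h i ≤ p i) (hq : ∀ i, h i ≤ q i)
    (hpq : ∀ i, h i = p i ∨ h i = q i) (hhK : ∀ i, h i ≤ K / n)
    (hsumX : ∑ i, h i ^ 2 / (2 * q i) = X) (hsumY : ∑ i, h i ^ 2 / (2 * p i) = Y)
    {l σ : ℝ} (hl : 0 < l) (hv : ∀ i, v i = l * p i) (hvσ : ∀ i, v i ≤ σ * q i)
    (hv1 : ∑ i, v i = 1) :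
    l * (∑ i, (p i - h i) + X) - (η + Real.exp (-(2 * (θ * X) ^ 2 * n / K ^ 2))
        + Real.exp (-(2 * (θ * Y) ^ 2 * n / K ^ 2)) + (l + σ) * (2 * θ * K + n * δ)) ≤
    expectedValue f v ((Measure.pi fun i => weakDist (q i) (h i)).map (rescale X))
      ((Measure.pi fun i => weakDist (p i) (h i)).map (rescale Y)) := by
  have := fun i => isProbabilityMeasure_weakDist (hh i) (hp i)
  have := fun i => isProbabilityMeasure_weakDist (hh i) (hq i)
  have hn0 : (0 : ℝ) < n := Nat.cast_pos.2 hn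
  set πb := Measure.pi fun i => weakDist (p i) (h i)
  set πa := Measure.pi fun i => weakDist (q i) (h i)
  have haea' : ∀ᵐ a ∂πa, ∀ i, a i ∈ Set.Icc 0 (K / n) :=
    (ae_pi_weakDist_mem hh hq).mono fun b hb i => ⟨(hb i).1, (hb i).2.trans (hhK i)⟩
  have haea : ∀ᵐ z ∂(πa.prod πb), ∀ i, z.1 i ∈ Set.Icc 0 (K / n) :=
    Measure.quasiMeasurePreserving_fst.ae haea'
  have haeb' : ∀ᵐ b ∂πb, ∀ i, 0 ≤ b i :=
    (ae_pi_weakDist_mem hh hp).mono fun b hb i => (hb i).1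
  have haeb : ∀ᵐ z ∂(πa.prod πb), ∀ i, 0 ≤ z.2 i :=
    Measure.quasiMeasurePreserving_snd.ae haeb'
  have hmeas : Measurable fun z : (Fin n → ℝ) × (Fin n → ℝ) => ∑ i, v i * f (z.1 i) (z.2 i) :=
    Finset.measurable_fun_sum _ fun i _ =>
      (hf.measurable_apply measurable_fst measurable_snd i).const_mul _
  have hresc : Measurable (Prod.map (rescale X) (rescale Y) :
      (Fin n → ℝ) × (Fin n → ℝ) → (Fin n → ℝ) × (Fin n → ℝ)) :=
    (measurable_rescale X).prodMap (measurable_rescale Y)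
  rw [expectedValue, Measure.map_prod_map _ _ (measurable_rescale X) (measurable_rescale Y),
    integral_map hresc.aemeasurable hmeas.aestronglyMeasurable]
  simp only [Prod.map_fst, Prod.map_snd]
  have hintf : ∀ i, Integrable (fun z : (Fin n → ℝ) × (Fin n → ℝ) =>
      f (rescale X z.1 i) (rescale Y z.2 i)) (πa.prod πb) := fun i => by
    refine hf.integrable_apply ((measurable_rescale X).comp measurable_fst)
      ((measurable_rescale Y).comp measurable_snd) hXM hYM ?_ ?_ i
    · exact haea.mono fun z hz => rescale_mem_pureStrategies hX.le fun j => (hz j).1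
    · exact haeb.mono fun z hz => rescale_mem_pureStrategies hY.le hz
  rw [integral_finsetSum _ fun i _ => (hintf i).const_mul _]
  simp only [integral_const_mul]
  -- This is the margin of `IsSharp.ge_of_rescale` with `κ = K / n`; over `n` battlefields it sums
  -- to `2 θ K + n δ`.
  set d := 2 * θ * (K / n) + δ with hd
  have hd0 : 0 ≤ d := by positivity
  set EX := Real.exp (-(2 * (θ * X) ^ 2 * n / K ^ 2))
  set EY := Real.exp (-(2 * (θ * Y) ^ 2 * n / K ^ 2))
  have hone : ∀ i, (p i - h i) / p i + h i ^ 2 / (2 * q i) / p i - d / p i - d / q i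
      - η - EX - EY ≤ ∫ z, f (rescale X z.1 i) (rescale Y z.2 i) ∂(πa.prod πb) := fun i => by
    have hm1 : MeasurableSet {z : (Fin n → ℝ) × (Fin n → ℝ) | z.2 i + d ≤ z.1 i} :=
      measurableSet_le (by fun_prop) (by fun_prop)
    have hm2 : MeasurableSet {a : Fin n → ℝ | X + θ * X ≤ ∑ j, a j} :=
      measurableSet_le (by fun_prop) (by fun_prop)
    have hm3 : MeasurableSet {b : Fin n → ℝ | ∑ j, b j ≤ Y - θ * Y} :=
      measurableSet_le (by fun_prop) (by fun_prop)
    have hi1 : Integrable ({z : (Fin n → ℝ) × (Fin n → ℝ) | z.2 i + d ≤ z.1 i}.indicator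
      (1 : (Fin n → ℝ) × (Fin n → ℝ) → ℝ)) (πa.prod πb) := (integrable_const 1).indicator hm1
    have hi2 : Integrable ((Prod.fst ⁻¹' {a : Fin n → ℝ | X + θ * X ≤ ∑ j, a j}).indicator
      (1 : (Fin n → ℝ) × (Fin n → ℝ) → ℝ)) (πa.prod πb) :=
      (integrable_const 1).indicator (measurable_fst hm2)
    have hi3 : Integrable ((Prod.snd ⁻¹' {b : Fin n → ℝ | ∑ j, b j ≤ Y - θ * Y}).indicator
      (1 : (Fin n → ℝ) × (Fin n → ℝ) → ℝ)) (πa.prod πb) :=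
      (integrable_const 1).indicator (measurable_snd hm3)
    have hi4 := hi1.sub (integrable_const η)
    have hi5 := hi4.sub hi2
    have hle := integral_mono_ae (hi5.sub hi3) (hintf i) (by
      filter_upwards [haea, haeb] with z hza hzb
      exact hf.ge_of_rescale hδ hη hX hXM hY hYM hθ hθ1 hza hzb i)
    rw [integral_sub' hi5 hi3, integral_sub' hi4 hi2, integral_sub' hi1 (integrable_const η),
      integral_indicator_one hm1, integral_indicator_one (measurable_fst hm2),
      integral_indicator_one (measurable_snd hm3), integral_const, probReal_univ,
      one_smul] at hle
    have h1 : (πa.prod πb).real {z | z.2 i + d ≤ z.1 i} =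
        ((weakDist (q i) (h i)).prod (weakDist (p i) (h i))).real {z | z.2 + d ≤ z.1} :=
      ((measurePreserving_eval (fun i => weakDist (q i) (h i)) i).prod
        (measurePreserving_eval (fun i => weakDist (p i) (h i)) i)).measureReal_preimage
        (s := {z : ℝ × ℝ | z.2 + d ≤ z.1})
        (measurableSet_le (by fun_prop) (by fun_prop)).nullMeasurableSet
    have h2 : (πa.prod πb).real (Prod.fst ⁻¹' {a : Fin n → ℝ | X + θ * X ≤ ∑ j, a j}) ≤ EX := by
      rw [measurePreserving_fst.measureReal_preimage hm2.nullMeasurableSet]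
      have := pi_real_sum_ge_le (μ := fun i => weakDist (q i) (h i)) hn hK
        (fun i => (ae_weakDist (q i) (hh i)).mono fun y hy => ⟨hy.1, hy.2.trans (hhK i)⟩)
        (mul_nonneg hθ.le hX.le)
      simpa only [integral_id_weakDist (hh _) (hq _), hsumX] using this
    have h3 : (πa.prod πb).real (Prod.snd ⁻¹' {b : Fin n → ℝ | ∑ j, b j ≤ Y - θ * Y}) ≤ EY := by
      rw [measurePreserving_snd.measureReal_preimage hm3.nullMeasurableSet]
      have := pi_real_sum_le_le (μ := fun i => weakDist (p i) (h i)) hn hK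
        (fun i => (ae_weakDist (p i) (hh i)).mono fun y hy => ⟨hy.1, hy.2.trans (hhK i)⟩)
        (mul_nonneg hθ.le hY.le)
      simpa only [integral_id_weakDist (hh _) (hp _), hsumY] using this
    have h4 := le_prod_weakDist_real (hh i) (hp i) (hq i) (hpq i) hd0
    linarith
  have hterm : ∀ i, l * (p i - h i) + l * (h i ^ 2 / (2 * q i)) - (l + σ) * d
      - (η + EX + EY) * v i ≤ v i * ∫ z, f (rescale X z.1 i) (rescale Y z.2 i) ∂(πa.prod πb) :=
    fun i => by
    have hpi : 0 < p i := (hh i).trans_le (hp i)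
    have hqi : 0 < q i := (hh i).trans_le (hq i)
    have hvi : 0 ≤ v i := by
      rw [hv i]
      positivity
    refine le_trans ?_ (mul_le_mul_of_nonneg_left (hone i) hvi)
    -- The loss `d / q i` is not on the scale of `p i`, so it needs the separate comparison of `v i`
    -- with `q i`.
    have h1 : v i * (d / q i) ≤ σ * d := by
      rw [mul_div_left_comm, mul_comm σ]
      gcongr
      rw [div_le_iff₀ hqi]
      exact hvσ i
    have h2 : v i * ((p i - h i) / p i + h i ^ 2 / (2 * q i) / p i - d / p i) =
        l * (p i - h i) + l * (h i ^ 2 / (2 * q i)) - l * d := by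
      rw [hv i]
      field_simp
    linarith
  refine le_trans (le_of_eq ?_) (Finset.sum_le_sum fun i _ => hterm i)
  simp only [Finset.sum_add_distrib, Finset.sum_sub_distrib, ← Finset.mul_sum, hv1, hsumX,
    Finset.sum_const, Finset.card_univ, Fintype.card_fin, nsmul_eq_mul, hd]
  field_simp
  ring

/-- An independently uniform strategy is nearly a best response to the other one. -/
lemma IsSharp.expectedValue_le_add (hf : IsSharp f M δ η) (hδ : 0 < δ) (hη : 0 ≤ η)
    (hX : 0 < X) (hXM : X ≤ M) (hY : 0 < Y) (hYM : Y ≤ M) (hθ : 0 < θ) (hθ1 : θ < 1)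
    (hn : 0 < n) {K : ℝ} (hK : 0 < K)
    {p q h : Fin n → ℝ} (hh : ∀ i, 0 < h i) (hp : ∀ i, h i ≤ p i) (hq : ∀ i, h i ≤ q i)
    (hpq : ∀ i, h i = p i ∨ h i = q i) (hhK : ∀ i, h i ≤ K / n)
    (hsumX : ∑ i, h i ^ 2 / (2 * q i) = X) (hsumY : ∑ i, h i ^ 2 / (2 * p i) = Y)
    {l σ : ℝ} (hl : 0 < l) (hv : ∀ i, v i = l * p i) (hvσ : ∀ i, v i ≤ σ * q i)
    (hv1 : ∑ i, v i = 1) {s : Measure (Fin n → ℝ)} (hs : s ∈ mixedStrategies n X) :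
    expectedValue f v s ((Measure.pi fun i => weakDist (p i) (h i)).map (rescale Y)) ≤
    expectedValue f v ((Measure.pi fun i => weakDist (q i) (h i)).map (rescale X))
      ((Measure.pi fun i => weakDist (p i) (h i)).map (rescale Y)) +
      (2 * η + Real.exp (-(2 * (θ * X) ^ 2 * n / K ^ 2))
        + 2 * Real.exp (-(2 * (θ * Y) ^ 2 * n / K ^ 2)) + l * (θ * X + (1 + θ) * (n * δ))
        + (l + σ) * (2 * θ * K + n * δ)) := by
  have h1 := hf.expectedValue_le hδ hη hXM hY hYM hθ hn hK hh hp hhK hsumY hl hv hv1 hs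
  have h2 := hf.le_expectedValue hδ hη hX hXM hY hYM hθ hθ1 hn hK hh hp hq hpq hhK hsumX hsumY hl
    hv hvσ hv1
  linarith

end Value

/-! ### Sharpness of the power and logit forms -/

section ContestSuccess

lemma ratio_mem_Icc {α u w : ℝ} (hα : α ∈ Set.Ioo (0 : ℝ) 1) (hu : 0 ≤ u) (hw : 0 ≤ w) :
    α * u / (α * u + (1 - α) * w) ∈ Set.Icc (0 : ℝ) 1 := by
  have h1 : 0 ≤ α * u := mul_nonneg hα.1.le hu
  have h2 : 0 ≤ (1 - α) * w := mul_nonneg (sub_nonneg.2 hα.2.le) hw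
  exact ⟨by positivity, div_le_one_of_le₀ (by linarith) (by linarith)⟩

lemma ratio_le {α u w τ : ℝ} (hα : α ∈ Set.Ioo (0 : ℝ) 1) (hu : 0 ≤ u) (hw : 0 < w)
    (h : u ≤ τ * w) : α * u / (α * u + (1 - α) * w) ≤ α / (1 - α) * τ := by
  have hα' : 0 < 1 - α := sub_pos.2 hα.2
  have h1 : 0 ≤ α * u := mul_nonneg hα.1.le hu
  calc α * u / (α * u + (1 - α) * w) ≤ α * u / ((1 - α) * w) := by
        gcongr
        linarith
    _ ≤ α * (τ * w) / ((1 - α) * w) := by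
        have := hα.1
        gcongr
    _ = α / (1 - α) * τ := by field_simp

/-- The complementary ratio is bounded by `ratio_le` with `α` and `1 - α` exchanged. -/
lemma le_ratio {α u w τ : ℝ} (hα : α ∈ Set.Ioo (0 : ℝ) 1) (hu : 0 < u) (hw : 0 ≤ w)
    (h : w ≤ τ * u) : 1 - (1 - α) / α * τ ≤ α * u / (α * u + (1 - α) * w) := by
  have hα' : 1 - α ∈ Set.Ioo (0 : ℝ) 1 := ⟨sub_pos.2 hα.2, by linarith [hα.1]⟩
  have h1 : 0 < α * u := mul_pos hα.1 hu
  have h2 : 0 ≤ (1 - α) * w := mul_nonneg hα'.1.le hw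
  have key := ratio_le hα' hw hu h
  rw [sub_sub_cancel] at key
  have : α * u / (α * u + (1 - α) * w) = 1 - (1 - α) * w / ((1 - α) * w + α * u) := by
    field_simp
    ring
  linarith

/-- On `[0, M]` an additive gap is a relative one: `x ≤ y - δ ≤ (1 - δ / M) y ≤ exp (-δ / M) y`. -/
lemma rpow_le_exp_mul_rpow {x y M δ R : ℝ} (hx : 0 ≤ x) (hδ : 0 < δ) (hR : 0 ≤ R)
    (hyM : y ≤ M) (h : x + δ ≤ y) : x ^ R ≤ Real.exp (-(R * (δ / M))) * y ^ R := by
  have hy : 0 < y := by linarith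
  have hM : 0 < M := hy.trans_le hyM
  have h1 : x ≤ Real.exp (-(δ / M)) * y := by
    have h2 := Real.one_sub_le_exp_neg (δ / M)
    have h3 : δ / M * y ≤ δ := by
      rw [div_mul_eq_mul_div, div_le_iff₀ hM]
      gcongr
    have := mul_le_mul_of_nonneg_right h2 hy.le
    linarith
  calc x ^ R ≤ (Real.exp (-(δ / M)) * y) ^ R := Real.rpow_le_rpow hx h1 hR
    _ = Real.exp (-(R * (δ / M))) * y ^ R := by
      rw [Real.mul_rpow (Real.exp_pos _).le hy.le, ← Real.exp_mul]
      ring_nf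

lemma isSharp_powerCSF {α R M δ η : ℝ} (hα : α ∈ Set.Ioo (0 : ℝ) 1) (hδ : 0 < δ) (hR : 0 < R)
    (hη : α / (1 - α) * Real.exp (-(R * (δ / M))) ≤ η)
    (hη' : (1 - α) / α * Real.exp (-(R * (δ / M))) ≤ η) :
    IsSharp (powerCSF α R).A M δ η where
  measurable := by
    refine Measurable.ite (p := fun z : ℝ × ℝ => z.1 = 0 ∧ z.2 = 0) ?_ (by fun_prop) (by fun_prop)
    exact (measurableSet_eq_fun measurable_fst measurable_const).inter
      (measurableSet_eq_fun measurable_snd measurable_const)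
  mem_Icc x hx y hy := by
    simp only [powerCSF]
    split_ifs
    · exact Set.Ioo_subset_Icc_self hα
    · exact ratio_mem_Icc hα (Real.rpow_nonneg hx.1 R) (Real.rpow_nonneg hy.1 R)
  le_of_add_le x hx y hy h := by
    have hy0 : 0 < y := by linarith [hx.1]
    simp only [powerCSF, hy0.ne', and_false, if_false]
    exact (ratio_le hα (Real.rpow_nonneg hx.1 R) (Real.rpow_pos_of_pos hy0 R)
      (rpow_le_exp_mul_rpow hx.1 hδ hR.le hy.2 h)).trans hη
  ge_of_add_le x hx y hy h := by
    have hx0 : 0 < x := by linarith [hy.1]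
    simp only [powerCSF, hx0.ne', false_and, if_false]
    exact (sub_le_sub_left hη' 1).trans (le_ratio hα (Real.rpow_pos_of_pos hx0 R)
      (Real.rpow_nonneg hy.1 R) (rpow_le_exp_mul_rpow hy.1 hδ hR.le hx.2 h))

lemma isSharp_logitCSF {α R M δ η : ℝ} (hα : α ∈ Set.Ioo (0 : ℝ) 1) (hR : 0 < R)
    (hη : α / (1 - α) * Real.exp (-(R * δ)) ≤ η) (hη' : (1 - α) / α * Real.exp (-(R * δ)) ≤ η) :
    IsSharp (logitCSF α R).A M δ η where
  measurable := by
    simp only [logitCSF, Function.uncurry_def]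
    fun_prop
  mem_Icc x _ y _ := ratio_mem_Icc hα (Real.exp_pos _).le (Real.exp_pos _).le
  le_of_add_le x _ y _ h := by
    refine (ratio_le hα (Real.exp_pos _).le (Real.exp_pos _) ?_).trans hη
    rw [← Real.exp_add, Real.exp_le_exp]
    nlinarith
  ge_of_add_le x _ y _ h := by
    refine (sub_le_sub_left hη' 1).trans (le_ratio hα (Real.exp_pos _) (Real.exp_pos _).le ?_)
    rw [← Real.exp_add, Real.exp_le_exp]
    nlinarith

/-- This symmetry reduces the deviations of B to those of A. -/
lemma powerCSF_B_swap (α R : ℝ) :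
    (fun x y => (powerCSF α R).B y x) = (powerCSF (1 - α) R).A := by
  ext x y
  simp only [powerCSF, sub_sub_cancel, and_comm (a := y = 0), add_comm (α * y ^ R)]

lemma logitCSF_B_swap (α R : ℝ) :
    (fun x y => (logitCSF α R).B y x) = (logitCSF (1 - α) R).A := by
  ext x y
  simp only [logitCSF, sub_sub_cancel, add_comm (α * Real.exp (y * R))]

end ContestSuccess

/-! ### Bounds on the normalized values and the constants `λ` -/

section Parameters

variable {wlo whi XA XB γ : ℝ} {wA wB w : Fin n → ℝ}

lemma normVal_mem_Icc (hn : 0 < n) (hwlo : 0 < wlo) (h : ∀ i, w i ∈ Set.Icc wlo whi) (i : Fin n) :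
    normVal w i ∈ Set.Icc ((whi / wlo)⁻¹ / n) (whi / wlo / n) := by
  have hn0 : (0 : ℝ) < n := Nat.cast_pos.2 hn
  have hwhi : 0 < whi := hwlo.trans_le ((h i).1.trans (h i).2)
  have h1 : n * wlo ≤ total w := by
    simpa [total] using Finset.card_nsmul_le_sum Finset.univ w wlo fun j _ => (h j).1
  have h2 : total w ≤ n * whi := by
    simpa [total] using Finset.sum_le_card_nsmul Finset.univ w whi fun j _ => (h j).2
  have hW : 0 < total w := lt_of_lt_of_le (by positivity) h1
  rw [normVal, inv_div]
  constructor
  · calc wlo / whi / n = wlo / (n * whi) := by field_simp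
      _ ≤ w i / total w := div_le_div₀ (hwlo.le.trans (h i).1) (h i).1 hW h2
  · calc w i / total w ≤ whi / (n * wlo) := div_le_div₀ hwhi.le (h i).2 (by positivity) h1
      _ = whi / wlo / n := by field_simp

lemma total_pos (hn : 0 < n) (hwlo : 0 < wlo) (h : ∀ i, w i ∈ Set.Icc wlo whi) : 0 < total w :=
  Finset.sum_pos (fun i _ => hwlo.trans_le (h i).1) ⟨⟨0, hn⟩, Finset.mem_univ _⟩

lemma sum_normVal (hW : total w ≠ 0) : ∑ i, normVal w i = 1 := by
  simp only [normVal, ← Finset.sum_div]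
  exact div_self hW

lemma sum_add_sum_compl_ite (s : Finset (Fin n)) (f g : Fin n → ℝ) :
    ∑ i ∈ s, f i + ∑ i ∈ sᶜ, g i = ∑ i, if i ∈ s then f i else g i := by
  rw [← Finset.sum_add_sum_compl s (fun i => if i ∈ s then f i else g i)]
  congr 1
  · exact Finset.sum_congr rfl fun i hi => (if_pos hi).symm
  · exact Finset.sum_congr rfl fun i hi => (if_neg (Finset.mem_compl.1 hi)).symm

lemma mem_omegaA_iff (hB : ∀ i, 0 < normVal wB i) (i : Fin n) :
    i ∈ omegaA wA wB γ ↔ γ * normVal wB i < normVal wA i := by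
  simp [omegaA, lt_div_iff₀ (hB i)]

lemma two_mul_lambdaA (hXB : 0 < XB) :
    2 * XB * lambdaA XB wA wB γ = ∑ i, if i ∈ omegaA wA wB γ then
      γ ^ 2 * (normVal wB i ^ 2 / normVal wA i) else normVal wA i := by
  rw [← sum_add_sum_compl_ite, ← Finset.mul_sum, lambdaA]
  field_simp

lemma two_mul_lambdaB (hXA : 0 < XA) (hγ : 0 < γ) :
    2 * XA * lambdaB XA wA wB γ = ∑ i, if i ∈ omegaA wA wB γ then
      normVal wB i else 1 / γ ^ 2 * (normVal wA i ^ 2 / normVal wB i) := by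
  rw [← sum_add_sum_compl_ite, ← Finset.mul_sum, lambdaB]
  field_simp

lemma lambdaA_pos (hXB : 0 < XB) (hγ : 0 < γ) (hn : 0 < n) (hA : ∀ i, 0 < normVal wA i)
    (hB : ∀ i, 0 < normVal wB i) : 0 < lambdaA XB wA wB γ := by
  have : 0 < 2 * XB * lambdaA XB wA wB γ := by
    rw [two_mul_lambdaA hXB]
    refine Finset.sum_pos (fun i _ => ?_) ⟨⟨0, hn⟩, Finset.mem_univ _⟩
    have := hA i
    have := hB i
    split_ifs <;> positivity
  exact pos_of_mul_pos_right this (by positivity)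

lemma lambdaB_pos (hXA : 0 < XA) (hγ : 0 < γ) (hn : 0 < n) (hA : ∀ i, 0 < normVal wA i)
    (hB : ∀ i, 0 < normVal wB i) : 0 < lambdaB XA wA wB γ := by
  have : 0 < 2 * XA * lambdaB XA wA wB γ := by
    rw [two_mul_lambdaB hXA hγ]
    refine Finset.sum_pos (fun i _ => ?_) ⟨⟨0, hn⟩, Finset.mem_univ _⟩
    have := hA i
    have := hB i
    split_ifs <;> positivity
  exact pos_of_mul_pos_right this (by positivity)

/-- The right side of the equation for `γ` is `2 X_B λ_A / (2 X_A λ_B)`. Apart from positivity of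
`γ`, this is all that is used about a solution. -/
lemma lambdaA_eq_mul_lambdaB (hXA : 0 < XA) (hXB : 0 < XB) (hn : 0 < n)
    (hA : ∀ i, 0 < normVal wA i) (hB : ∀ i, 0 < normVal wB i)
    (hγ : γ ∈ gammaSolutions XA XB wA wB) :
    lambdaA XB wA wB γ = γ * lambdaB XA wA wB γ := by
  obtain ⟨hγ0, h⟩ := hγ
  have hpos := lambdaB_pos hXA hγ0 hn hA hB
  rw [Finset.mul_sum, Finset.mul_sum, sum_add_sum_compl_ite, sum_add_sum_compl_ite,
    ← two_mul_lambdaA hXB, ← two_mul_lambdaB hXA hγ0] at h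
  field_simp at h
  linarith

/-- On `Ω_A(γ)` one has `γ v^B_i < v^A_i`, so each summand of `2 X_B λ_A` is at most `v^A_i`, and
these sum to one. -/
lemma lambdaA_le (hXB : 0 < XB) (hγ : 0 < γ) (hA : ∀ i, 0 < normVal wA i)
    (hB : ∀ i, 0 < normVal wB i) (h1 : ∑ i, normVal wA i = 1) :
    lambdaA XB wA wB γ ≤ 1 / (2 * XB) := by
  rw [le_div_iff₀ (by positivity), mul_comm, two_mul_lambdaA hXB]
  refine (Finset.sum_le_sum fun i _ => ?_).trans_eq h1
  split_ifs with h
  · rw [mem_omegaA_iff hB] at h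
    have hAi := hA i
    have hBi := hB i
    rw [← mul_div_assoc, div_le_iff₀ hAi, ← mul_pow, ← sq]
    gcongr
  · exact le_rfl

lemma lambdaB_le (hXA : 0 < XA) (hγ : 0 < γ) (hA : ∀ i, 0 < normVal wA i)
    (hB : ∀ i, 0 < normVal wB i) (h1 : ∑ i, normVal wB i = 1) :
    lambdaB XA wA wB γ ≤ 1 / (2 * XA) := by
  rw [le_div_iff₀ (by positivity), mul_comm, two_mul_lambdaB hXA hγ]
  refine (Finset.sum_le_sum fun i _ => ?_).trans_eq h1
  split_ifs with h
  · exact le_rfl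
  · rw [mem_omegaA_iff hB, not_lt] at h
    have hAi := hA i
    have hBi := hB i
    rw [one_div_mul_eq_div, div_div, div_le_iff₀ (by positivity)]
    calc normVal wA i ^ 2 ≤ (γ * normVal wB i) ^ 2 := by gcongr
      _ = _ := by ring

lemma le_sq_div {ρ x y : ℝ} (hρ : 1 ≤ ρ) (hn : 0 < n) (hx : x ∈ Set.Icc (ρ⁻¹ / n) (ρ / n))
    (hy : y ∈ Set.Icc (ρ⁻¹ / n) (ρ / n)) : (ρ ^ 3)⁻¹ / n ≤ x ^ 2 / y := by
  have hn0 : (0 : ℝ) < n := Nat.cast_pos.2 hn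
  have hρ0 : 0 < ρ := by linarith
  have hy0 : 0 < y := lt_of_lt_of_le (by positivity) hy.1
  calc (ρ ^ 3)⁻¹ / n = (ρ⁻¹ / n) ^ 2 / (ρ / n) := by field_simp
    _ ≤ x ^ 2 / y := by
      gcongr
      · exact hx.1
      · exact hy.2

lemma le_of_mem {ρ x : ℝ} (hρ : 1 ≤ ρ) (hx : x ∈ Set.Icc (ρ⁻¹ / n) (ρ / n)) :
    (ρ ^ 3)⁻¹ / n ≤ x := by
  refine le_trans ?_ hx.1
  gcongr
  exact le_self_pow₀ hρ (by norm_num)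

/-- For `γ ≥ 1` the factor `γ²` only helps `λ_A`, and for `γ ≤ 1` the factor `1 / γ²` only helps
`λ_B`. One lower bound suffices to bound `min (p i) (q i)`, so no bounds on `γ` are needed. -/
lemma le_two_mul_lambda {ρ : ℝ} (hρ : 1 ≤ ρ) (hXA : 0 < XA) (hXB : 0 < XB) (hγ : 0 < γ)
    (hn : 0 < n) (hA : ∀ i, normVal wA i ∈ Set.Icc (ρ⁻¹ / n) (ρ / n))
    (hB : ∀ i, normVal wB i ∈ Set.Icc (ρ⁻¹ / n) (ρ / n)) :
    (ρ ^ 3)⁻¹ ≤ 2 * XB * lambdaA XB wA wB γ ∨ (ρ ^ 3)⁻¹ ≤ 2 * XA * lambdaB XA wA wB γ := by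
  have hn0 : (0 : ℝ) < n := Nat.cast_pos.2 hn
  have hρ0 : 0 < ρ := by linarith
  have hc : (ρ ^ 3)⁻¹ = ∑ _i : Fin n, (ρ ^ 3)⁻¹ / n := by
    rw [Finset.sum_const, Finset.card_univ, Fintype.card_fin, nsmul_eq_mul]
    field_simp
  rcases le_total 1 γ with h | h
  · left
    rw [two_mul_lambdaA hXB, hc]
    refine Finset.sum_le_sum fun i _ => ?_
    split_ifs
    · have h1 := le_sq_div hρ hn (hB i) (hA i)
      refine h1.trans (le_mul_of_one_le_left (le_trans (by positivity) h1) ?_)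
      exact one_le_pow₀ h
    · exact le_of_mem hρ (hA i)
  · right
    rw [two_mul_lambdaB hXA hγ, hc]
    refine Finset.sum_le_sum fun i _ => ?_
    split_ifs
    · exact le_of_mem hρ (hB i)
    · have h1 := le_sq_div hρ hn (hA i) (hB i)
      refine h1.trans (le_mul_of_one_le_left (le_trans (by positivity) h1) ?_)
      exact (one_le_div (by positivity)).2 (pow_le_one₀ hγ.le h)

end Parameters

/-! ### From near-optimal values to an approximate equilibrium -/

section Equilibrium

variable {wlo whi XA XB γ : ℝ} {wA wB : Fin n → ℝ}

lemma mem_omegaA_iff_div_lt_div {lA lB : ℝ} (hlA0 : 0 < lA) (hlB0 : 0 < lB) (hAB : lA = γ * lB)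
    (hB : ∀ i, 0 < normVal wB i) (i : Fin n) :
    i ∈ omegaA wA wB γ ↔ normVal wB i / lB < normVal wA i / lA := by
  rw [mem_omegaA_iff hB, div_lt_div_iff₀ hlB0 hlA0, hAB, ← mul_assoc, mul_lt_mul_iff_left₀ hlB0,
    mul_comm]

lemma distA_eq_weakDist {lA lB : ℝ} (hlA : lambdaA XB wA wB γ = lA)
    (hlB : lambdaB XA wA wB γ = lB) (hlA0 : 0 < lA) (hlB0 : 0 < lB) (hAB : lA = γ * lB)
    (hB : ∀ i, 0 < normVal wB i) (i : Fin n) :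
    distA XA XB wA wB γ i =
      weakDist (normVal wB i / lB) (min (normVal wA i / lA) (normVal wB i / lB)) := by
  have key := mem_omegaA_iff_div_lt_div (wA := wA) hlA0 hlB0 hAB hB i
  rw [distA, hlA, hlB]
  split_ifs with h
  · rw [min_eq_right (key.1 h).le, strongDist_eq_weakDist]
  · rw [min_eq_left (not_lt.1 (mt key.2 h))]

lemma distB_eq_weakDist {lA lB : ℝ} (hlA : lambdaA XB wA wB γ = lA)
    (hlB : lambdaB XA wA wB γ = lB) (hlA0 : 0 < lA) (hlB0 : 0 < lB) (hAB : lA = γ * lB)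
    (hB : ∀ i, 0 < normVal wB i) (i : Fin n) :
    distB XA XB wA wB γ i =
      weakDist (normVal wA i / lA) (min (normVal wA i / lA) (normVal wB i / lB)) := by
  have key := mem_omegaA_iff_div_lt_div (wA := wA) hlA0 hlB0 hAB hB i
  rw [distB, hlA, hlB]
  split_ifs with h
  · rw [min_eq_right (key.1 h).le]
  · rw [min_eq_left (not_lt.1 (mt key.2 h)), strongDist_eq_weakDist]

/-- The strategy of A spends its budget in expectation. -/
lemma sum_mean_distA {lA lB : ℝ} (hXA : 0 < XA) (hγ : 0 < γ)
    (hlB : lambdaB XA wA wB γ = lB) (hlA0 : 0 < lA) (hlB0 : 0 < lB) (hAB : lA = γ * lB)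
    (hA : ∀ i, 0 < normVal wA i) (hB : ∀ i, 0 < normVal wB i) :
    ∑ i, min (normVal wA i / lA) (normVal wB i / lB) ^ 2 / (2 * (normVal wB i / lB)) = XA := by
  have h := two_mul_lambdaB (wA := wA) (wB := wB) hXA hγ
  rw [hlB] at h
  have : XA = (2 * XA * lB) * (1 / (2 * lB)) := by field_simp
  rw [this, h, Finset.sum_mul]
  refine Finset.sum_congr rfl fun i _ => ?_
  have hAi := hA i
  have hBi := hB i
  have key := mem_omegaA_iff_div_lt_div (wA := wA) hlA0 hlB0 hAB hB i
  split_ifs with h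
  · rw [min_eq_right (key.1 h).le]
    field_simp
  -- Here the minimum is `v^A_i / λ_A`, and `λ_A = γ λ_B` produces the factor `1 / γ²` of the
  -- definition of `λ_B`.
  · rw [min_eq_left (not_lt.1 (mt key.2 h)), hAB]
    field_simp

/-- The strategy of B spends its budget in expectation. -/
lemma sum_mean_distB {lA lB : ℝ} (hXB : 0 < XB) (hγ : 0 < γ)
    (hlA : lambdaA XB wA wB γ = lA) (hlA0 : 0 < lA) (hlB0 : 0 < lB) (hAB : lA = γ * lB)
    (hA : ∀ i, 0 < normVal wA i) (hB : ∀ i, 0 < normVal wB i) :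
    ∑ i, min (normVal wA i / lA) (normVal wB i / lB) ^ 2 / (2 * (normVal wA i / lA)) = XB := by
  have h := two_mul_lambdaA (wA := wA) (wB := wB) (γ := γ) hXB
  rw [hlA] at h
  have : XB = (2 * XB * lA) * (1 / (2 * lA)) := by field_simp
  rw [this, h, Finset.sum_mul]
  refine Finset.sum_congr rfl fun i _ => ?_
  have hAi := hA i
  have hBi := hB i
  have key := mem_omegaA_iff_div_lt_div (wA := wA) hlA0 hlB0 hAB hB i
  split_ifs with h
  · rw [min_eq_right (key.1 h).le, hAB]
    field_simp
  · rw [min_eq_left (not_lt.1 (mt key.2 h))]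
    field_simp

lemma payoffA_eq (ζ : CSFPair) {w : Fin n → ℝ} (hW : total w ≠ 0) (s t : Measure (Fin n → ℝ)) :
    payoffA ζ w s t = total w * expectedValue ζ.A (normVal w) s t := by
  rw [payoffA, expectedValue, ← integral_const_mul]
  congr 1 with z
  rw [purePayoffA, Finset.mul_sum]
  refine Finset.sum_congr rfl fun i _ => ?_
  rw [normVal]
  field_simp

lemma payoffB_eq (ζ : CSFPair) {w : Fin n → ℝ} (hW : total w ≠ 0) (s t : Measure (Fin n → ℝ))
    [SFinite s] [SFinite t] :
    payoffB ζ w s t = total w * expectedValue (fun x y => ζ.B y x) (normVal w) t s := by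
  rw [payoffB, expectedValue, ← integral_const_mul, ← integral_prod_swap]
  congr 1 with z
  rw [purePayoffB, Finset.mul_sum]
  refine Finset.sum_congr rfl fun i _ => ?_
  rw [normVal, Prod.fst_swap, Prod.snd_swap]
  field_simp

/-- `IsSharp.expectedValue_le_add` with an error that is uniform in the two players. -/
lemma IsSharp.expectedValue_le_add_of_le {f : ℝ → ℝ → ℝ} {X Y m M δ η θ Λ ρ ε : ℝ}
    {v u : Fin n → ℝ} (hf : IsSharp f M δ η) (hδ : 0 < δ)
    (hη : 0 ≤ η) (hm : 0 < m) (hmX : m ≤ X) (hXM : X ≤ M) (hmY : m ≤ Y) (hYM : Y ≤ M)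
    (hθ : 0 < θ) (hθ1 : θ < 1) (hn : 0 < n) {K : ℝ} (hK : 0 < K) {l l' : ℝ} (hl : 0 < l)
    (hl' : 0 < l') (hlΛ : l ≤ Λ) (hlΛ' : l' ≤ Λ) (hv : ∀ i, 0 < v i) (hu : ∀ i, 0 < u i)
    (hvu : ∀ i, v i ≤ ρ ^ 2 * u i) (hhK : ∀ i, min (v i / l) (u i / l') ≤ K / n)
    (hsumX : ∑ i, min (v i / l) (u i / l') ^ 2 / (2 * (u i / l')) = X)
    (hsumY : ∑ i, min (v i / l) (u i / l') ^ 2 / (2 * (v i / l)) = Y)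
    (hv1 : ∑ i, v i = 1)
    (hε : 2 * η + 3 * Real.exp (-(2 * (θ * m) ^ 2 * n / K ^ 2)) + Λ * (θ * M + 2 * (n * δ))
      + Λ * (1 + ρ ^ 2) * (2 * θ * K + n * δ) ≤ ε)
    {s : Measure (Fin n → ℝ)} (hs : s ∈ mixedStrategies n X) :
    expectedValue f v s
      ((Measure.pi fun i => weakDist (v i / l) (min (v i / l) (u i / l'))).map (rescale Y)) ≤
    expectedValue f v
      ((Measure.pi fun i => weakDist (u i / l') (min (v i / l) (u i / l'))).map (rescale X))
      ((Measure.pi fun i => weakDist (v i / l) (min (v i / l) (u i / l'))).map (rescale Y)) + ε := by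
  have hn0 : (0 : ℝ) < n := Nat.cast_pos.2 hn
  have hX : 0 < X := hm.trans_le hmX
  have hY : 0 < Y := hm.trans_le hmY
  refine (hf.expectedValue_le_add hδ hη hX hXM hY hYM hθ hθ1 hn hK
    (p := fun i => v i / l) (q := fun i => u i / l') (h := fun i => min (v i / l) (u i / l'))
    -- This `σ` turns `v i ≤ ρ² u i` into `v i ≤ σ q i`, since `q i = u i / l'`.
    (l := l) (σ := ρ ^ 2 * l') (fun i => lt_min (div_pos (hv i) hl) (div_pos (hu i) hl'))
    (fun i => min_le_left _ _) (fun i => min_le_right _ _) (fun i => min_choice _ _) hhK hsumX hsumY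
    hl (fun i => by field_simp) (fun i => ?_) hv1 hs).trans ?_
  · refine (hvu i).trans_eq ?_
    field_simp
  · have e1 : Real.exp (-(2 * (θ * X) ^ 2 * n / K ^ 2)) ≤
        Real.exp (-(2 * (θ * m) ^ 2 * n / K ^ 2)) := by gcongr
    have e2 : Real.exp (-(2 * (θ * Y) ^ 2 * n / K ^ 2)) ≤
        Real.exp (-(2 * (θ * m) ^ 2 * n / K ^ 2)) := by gcongr
    have e3 : l * (θ * X + (1 + θ) * (n * δ)) ≤ Λ * (θ * M + 2 * (n * δ)) := by
      gcongr <;> linarith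
    have e4 : (l + ρ ^ 2 * l') * (2 * θ * K + n * δ) ≤
        Λ * (1 + ρ ^ 2) * (2 * θ * K + n * δ) := by
      gcongr
      nlinarith [mul_le_mul_of_nonneg_left hlΛ' (sq_nonneg ρ)]
    linarith

/-- The independently uniform strategies form an approximate equilibrium for contest success
functions that are sharp enough. -/
lemma isApproxEquilibrium_iu {ζ : CSFPair} {δ η θ ε : ℝ} (hwlo : 0 < wlo) (hw : wlo ≤ whi)
    (hXA : 0 < XA) (hXB : XA ≤ XB) (hζA : IsSharp ζ.A XB δ η)
    (hζB : IsSharp (fun x y => ζ.B y x) XB δ η) (hδ : 0 < δ) (hη : 0 ≤ η) (hθ : 0 < θ)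
    (hθ1 : θ < 1) (hn : 0 < n) (h0 : AssumptionA0 wlo whi wA wB)
    (hε : 2 * η + 3 * Real.exp (-(2 * (θ * XA) ^ 2 * n / (2 * XB * (whi / wlo) ^ 4) ^ 2))
      + 1 / (2 * XA) * (θ * XB + 2 * (n * δ))
      + 1 / (2 * XA) * (1 + (whi / wlo) ^ 2)
        * (2 * θ * (2 * XB * (whi / wlo) ^ 4) + n * δ) ≤ ε) (hε0 : 0 ≤ ε)
    (hγ : γ ∈ gammaSolutions XA XB wA wB) :
    IsApproxEquilibrium ζ XA XB wA wB (ε * max (total wA) (total wB))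
      (iuA XA XB wA wB γ) (iuB XA XB wA wB γ) := by
  have hn0 : (0 : ℝ) < n := Nat.cast_pos.2 hn
  have hXB0 : 0 < XB := hXA.trans_le hXB
  have hρ : 1 ≤ whi / wlo := (one_le_div hwlo).2 hw
  have hA0 := normVal_mem_Icc hn hwlo fun i => (h0 i).1
  have hB0 := normVal_mem_Icc hn hwlo fun i => (h0 i).2
  set ρ := whi / wlo
  have hρ0 : 0 < ρ := by linarith
  have hA : ∀ i, 0 < normVal wA i := fun i => lt_of_lt_of_le (by positivity) (hA0 i).1
  have hB : ∀ i, 0 < normVal wB i := fun i => lt_of_lt_of_le (by positivity) (hB0 i).1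
  have hWA : 0 < total wA := total_pos hn hwlo fun i => (h0 i).1
  have hWB : 0 < total wB := total_pos hn hwlo fun i => (h0 i).2
  have hA1 := sum_normVal hWA.ne'
  have hB1 := sum_normVal hWB.ne'
  have hγ0 : 0 < γ := hγ.1
  have hlA0 := lambdaA_pos hXB0 hγ0 hn hA hB
  have hlB0 := lambdaB_pos hXA hγ0 hn hA hB
  have hAB := lambdaA_eq_mul_lambdaB hXA hXB0 hn hA hB hγ
  have hlA1 : lambdaA XB wA wB γ ≤ 1 / (2 * XA) :=
    (lambdaA_le hXB0 hγ0 hA hB hA1).trans (by gcongr)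
  have hlB1 := lambdaB_le hXA hγ0 hA hB hB1
  have hor := le_two_mul_lambda hρ hXA hXB0 hγ0 hn hA0 hB0
  obtain ⟨lA, hlA⟩ : ∃ l, lambdaA XB wA wB γ = l := ⟨_, rfl⟩
  obtain ⟨lB, hlB⟩ : ∃ l, lambdaB XA wA wB γ = l := ⟨_, rfl⟩
  have hdA : iuA XA XB wA wB γ = (Measure.pi fun i => weakDist (normVal wB i / lB)
      (min (normVal wA i / lA) (normVal wB i / lB))).map (rescale XA) := by
    rw [hlA] at hlA0 hAB
    rw [hlB] at hlB0 hAB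
    rw [iuA]
    congr 2
    exact funext fun i => distA_eq_weakDist hlA hlB hlA0 hlB0 hAB hB i
  have hdB : iuB XA XB wA wB γ = (Measure.pi fun i => weakDist (normVal wA i / lA)
      (min (normVal wA i / lA) (normVal wB i / lB))).map (rescale XB) := by
    rw [hlA] at hlA0 hAB
    rw [hlB] at hlB0 hAB
    rw [iuB]
    congr 2
    exact funext fun i => distB_eq_weakDist hlA hlB hlA0 hlB0 hAB hB i
  rw [hlA] at hlA0 hAB hlA1 hor
  rw [hlB] at hlB0 hAB hlB1 hor
  have hsumA := sum_mean_distA hXA hγ0 hlB hlA0 hlB0 hAB hA hB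
  have hsumB := sum_mean_distB hXB0 hγ0 hlA hlA0 hlB0 hAB hA hB
  have hpos : ∀ i, 0 < min (normVal wA i / lA) (normVal wB i / lB) := fun i =>
    lt_min (div_pos (hA i) hlA0) (div_pos (hB i) hlB0)
  have hratio : ∀ x ∈ Set.Icc (ρ⁻¹ / n) (ρ / n), ∀ y ∈ Set.Icc (ρ⁻¹ / n) (ρ / n),
      x ≤ ρ ^ 2 * y := fun x hx y hy =>
    calc x ≤ ρ / n := hx.2
      _ = ρ ^ 2 * (ρ⁻¹ / n) := by field_simp
      _ ≤ ρ ^ 2 * y := by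
        gcongr
        exact hy.1
  -- The power `ρ ^ 4` in `K` is one factor from `x ≤ ρ / n` and three from the lower bound on `l`.
  have hbound : ∀ x ∈ Set.Icc (ρ⁻¹ / n) (ρ / n), ∀ l > 0, (ρ ^ 3)⁻¹ ≤ 2 * XB * l →
      x / l ≤ 2 * XB * ρ ^ 4 / n := fun x hx l hl h => by
    rw [div_le_iff₀ hl]
    calc x ≤ ρ ^ 4 / n * (ρ ^ 3)⁻¹ := hx.2.trans_eq (by field_simp)
      _ ≤ ρ ^ 4 / n * (2 * XB * l) := by gcongr
      _ = _ := by ring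
  have hK : ∀ i, min (normVal wA i / lA) (normVal wB i / lB) ≤ 2 * XB * ρ ^ 4 / n := fun i => by
    rcases hor with h | h
    · exact (min_le_left _ _).trans (hbound _ (hA0 i) lA hlA0 h)
    · exact (min_le_right _ _).trans (hbound _ (hB0 i) lB hlB0 (h.trans (by gcongr)))
  have hsA : iuA XA XB wA wB γ ∈ mixedStrategies n XA := by
    have := fun i => isProbabilityMeasure_weakDist (hpos i) (min_le_right _ _)
    rw [hdA]
    exact map_rescale_mem_mixedStrategies hXA.le
      ((ae_pi_weakDist_mem hpos fun i => min_le_right _ _).mono fun b hb i => (hb i).1)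
  have hsB : iuB XA XB wA wB γ ∈ mixedStrategies n XB := by
    have := fun i => isProbabilityMeasure_weakDist (hpos i) (min_le_left _ _)
    rw [hdB]
    exact map_rescale_mem_mixedStrategies hXB0.le
      ((ae_pi_weakDist_mem hpos fun i => min_le_left _ _).mono fun b hb i => (hb i).1)
  refine ⟨hsA, hsB, fun s hs => ?_, fun t ht => ?_⟩
  · rw [payoffA_eq ζ hWA.ne', payoffA_eq ζ hWA.ne', hdA, hdB]
    have key := hζA.expectedValue_le_add_of_le (v := normVal wA) (u := normVal wB) hδ hη hXA le_rfl
      hXB hXB le_rfl hθ hθ1 hn (by positivity) hlA0 hlB0 hlA1 hlB1 hA hB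
      (fun i => hratio _ (hA0 i) _ (hB0 i)) hK hsumA hsumB hA1 hε hs
    have h1 := mul_le_mul_of_nonneg_left key hWA.le
    have h2 := mul_le_mul_of_nonneg_left (le_max_left (total wA) (total wB)) hε0
    linarith
  · have := hsA.1
    have := hsB.1
    have := ht.1
    rw [payoffB_eq ζ hWB.ne', payoffB_eq ζ hWB.ne', hdA, hdB]
    -- With the minimum written in the other order, the statement for B is the one for A with the
    -- players exchanged.
    simp only [min_comm (normVal wA _ / lA)] at hK hsumA hsumB ⊢
    have key := hζB.expectedValue_le_add_of_le (v := normVal wB) (u := normVal wA) hδ hη hXA hXB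
      le_rfl le_rfl hXB hθ hθ1 hn (by positivity) hlB0 hlA0 hlB1 hlA1 hB hA
      (fun i => hratio _ (hB0 i) _ (hA0 i)) hK hsumB hsumA hB1 hε ht
    have h1 := mul_le_mul_of_nonneg_left key hWB.le
    have h2 := mul_le_mul_of_nonneg_left (le_max_right (total wA) (total wB)) hε0
    linarith

end Equilibrium

/-! ### Choice of the constants -/

/-- Of the four copies of the maximum, one supplies `ln (1 / ε)` and three supply `3`, and `exp 3 ≥
12`. -/
lemma exp_neg_four_mul_max_le {ε : ℝ} (hε : 0 < ε) :
    Real.exp (-(4 * max 1 (Real.log ε⁻¹))) ≤ ε / 12 := by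
  have h1 : -(4 * max 1 (Real.log ε⁻¹)) ≤ Real.log ε + -3 := by
    have := le_max_left 1 (Real.log ε⁻¹)
    have := le_max_right 1 (Real.log ε⁻¹)
    rw [Real.log_inv] at *
    linarith
  have h2 : 12 ≤ Real.exp 3 := by
    have h3 : Real.exp 3 = Real.exp 1 ^ 3 := by
      rw [← Real.exp_nat_mul]
      norm_num
    rw [h3]
    calc (12 : ℝ) ≤ 2.7 ^ 3 := by norm_num
      _ ≤ Real.exp 1 ^ 3 := by
        gcongr
        linarith [Real.exp_one_gt_d9]
  refine (Real.exp_le_exp.2 h1).trans ?_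
  rw [Real.exp_add, Real.exp_log hε, Real.exp_neg, ← div_eq_mul_inv]
  gcongr

/-- The exponential is at most `ε ^ 5`: one power pays for the prefactor, which is at most `1 / ε`,
three give the `1 / 8`, and one remains. This is where `ε < min α (1 - α)` makes the constants
independent of `α`. -/
lemma div_mul_exp_le {β ε t : ℝ} (hβ : β ∈ Set.Ioo (0 : ℝ) 1) (hε : 0 < ε) (hεβ : ε < 1 - β)
    (hε2 : ε ≤ 1 / 2) (ht : 5 * Real.log (1 / ε) ≤ t) :
    β / (1 - β) * Real.exp (-t) ≤ ε / 8 := by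
  have h1 : Real.exp (-t) ≤ ε ^ 5 := by
    rw [← Real.exp_log (pow_pos hε 5), Real.exp_le_exp, Real.log_pow]
    rw [one_div, Real.log_inv] at ht
    push_cast
    linarith
  calc β / (1 - β) * Real.exp (-t) ≤ 1 / ε * ε ^ 5 := by
        have := hβ.2.le
        gcongr
    _ = ε * ε ^ 3 := by field_simp
    _ ≤ ε * (1 / 2) ^ 3 := by gcongr
    _ = ε / 8 := by ring

end LotteryBlotto

open LotteryBlotto in
theorem mainTheorem8 (wlo whi XA XB α : ℝ) (hwlo : 0 < wlo) (hw : wlo ≤ whi)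
    (hXA : 0 < XA) (hXB : XA ≤ XB) (hα : α ∈ Set.Ioo (0 : ℝ) 1) :
    ∃ L > (0 : ℝ), ∃ C > (0 : ℝ), ∀ ε ∈ Set.Ioo (0 : ℝ) (min α (1 - α)),
      ∀ (n : ℕ), 3 ≤ n → ∀ (wA wB : Fin n → ℝ), LotteryBlotto.AssumptionA0 wlo whi wA wB →
      ∀ (R : ℝ), L * (ε ^ 2)⁻¹ * max 1 (Real.log ε⁻¹) ≤ (n : ℝ) →
        C * ((n : ℝ) / ε * Real.log (1 / ε)) ≤ R →
      ∀ γ ∈ LotteryBlotto.gammaSolutions XA XB wA wB,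
        LotteryBlotto.IsApproxEquilibrium (LotteryBlotto.powerCSF α R) XA XB wA wB
            (ε * max (LotteryBlotto.total wA) (LotteryBlotto.total wB))
            (LotteryBlotto.iuA XA XB wA wB γ) (LotteryBlotto.iuB XA XB wA wB γ) ∧
          LotteryBlotto.IsApproxEquilibrium (LotteryBlotto.logitCSF α R) XA XB wA wB
            (ε * max (LotteryBlotto.total wA) (LotteryBlotto.total wB))
            (LotteryBlotto.iuA XA XB wA wB γ) (LotteryBlotto.iuB XA XB wA wB γ) := by
  have hXB0 : 0 < XB := hXA.trans_le hXB
  have hρ0 : 0 < whi / wlo := div_pos (hwlo.trans_le hw) hwlo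
  obtain ⟨Λ, hΛ⟩ : ∃ Λ, Λ = 1 / (2 * XA) := ⟨_, rfl⟩
  obtain ⟨K, hK⟩ : ∃ K, K = 2 * XB * (whi / wlo) ^ 4 := ⟨_, rfl⟩
  have hΛ0 : 0 < Λ := hΛ ▸ by positivity
  have hK0 : 0 < K := hK ▸ by positivity
  set ρ := whi / wlo
  -- `D - 1` and `D' - 1` are the coefficients of `θ` and of `n δ` in the error of
  -- `isApproxEquilibrium_iu`. With `θ = c ε` and `n δ = c' ε` each of the two parts is at most `ε /
  -- 4`.
  set D := 1 + Λ * XB + 2 * Λ * (1 + ρ ^ 2) * K with hD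
  set D' := 1 + Λ * (3 + ρ ^ 2) with hD'
  have hD1 : 1 ≤ D := by
    have : 0 ≤ Λ * XB + 2 * Λ * (1 + ρ ^ 2) * K := by positivity
    linarith
  have hD0 : 0 < D := by linarith
  have hD'0 : 0 < D' := by positivity
  set c := 1 / (4 * D) with hc
  set c' := 1 / (4 * D') with hc'
  have hc0 : 0 < c := by positivity
  have hc'0 : 0 < c' := by positivity
  have hc1 : c ≤ 1 := by
    rw [hc, div_le_one (by positivity)]
    linarith
  -- The first constant makes the Hoeffding exponent at least `4 max 1 (ln (1 / ε))`. The second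
  -- makes both `R δ` (logit form) and `R δ / X_B` (power form) at least `5 ln (1 / ε)`.
  refine ⟨2 * K ^ 2 / (c * XA) ^ 2, by positivity, 5 * max XB 1 / c', by positivity, ?_⟩
  rintro ε ⟨hε0, hεm⟩ n hn wA wB h0 R hnL hRC γ hγ
  obtain ⟨hεα, hεα'⟩ := lt_min_iff.1 hεm
  have hε2 : ε ≤ 1 / 2 := by linarith
  have hn0 : 0 < n := by linarith
  have hn0' : (0 : ℝ) < n := Nat.cast_pos.2 hn0
  have hlog : 0 < Real.log (1 / ε) := Real.log_pos (by
    rw [lt_div_iff₀ hε0]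
    linarith)
  have hR0 : 0 < R := lt_of_lt_of_le (by positivity) hRC
  set δ := c' * ε / n with hδ
  have hδ0 : 0 < δ := by positivity
  have hnδ : n * δ = c' * ε := by
    rw [hδ]
    field_simp
  have hRδ : 5 * max XB 1 * Real.log (1 / ε) ≤ R * δ := by
    calc 5 * max XB 1 * Real.log (1 / ε)
        = 5 * max XB 1 / c' * (n / ε * Real.log (1 / ε)) * δ := by
          rw [hδ]
          field_simp
      _ ≤ R * δ := by gcongr
  have hlogit : 5 * Real.log (1 / ε) ≤ R * δ := by
    refine le_trans ?_ hRδ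
    gcongr
    linarith [le_max_right XB 1]
  have hpower : 5 * Real.log (1 / ε) ≤ R * (δ / XB) := by
    rw [← mul_div_assoc, le_div_iff₀ hXB0]
    refine le_trans ?_ hRδ
    rw [mul_right_comm]
    gcongr
    exact le_max_left _ _
  have hexp : Real.exp (-(2 * (c * ε * XA) ^ 2 * n / K ^ 2)) ≤ ε / 12 := by
    refine le_trans (Real.exp_le_exp.2 (neg_le_neg ?_)) (exp_neg_four_mul_max_le hε0)
    calc 4 * max 1 (Real.log ε⁻¹) = 2 * (c * ε * XA) ^ 2 *
          (2 * K ^ 2 / (c * XA) ^ 2 * (ε ^ 2)⁻¹ * max 1 (Real.log ε⁻¹)) / K ^ 2 := by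
          field_simp
          ring
      _ ≤ 2 * (c * ε * XA) ^ 2 * n / K ^ 2 := by gcongr
  -- Four quarters of `ε`: the blur `2 η`, the three Hoeffding tails, the terms in `θ` and the terms
  -- in `n δ`.
  have herr : 2 * (ε / 8) + 3 * Real.exp (-(2 * (c * ε * XA) ^ 2 * n / K ^ 2))
      + Λ * (c * ε * XB + 2 * (n * δ)) + Λ * (1 + ρ ^ 2) * (2 * (c * ε) * K + n * δ) ≤ ε := by
    have e1 : (D - 1) * c ≤ 1 / 4 := by
      rw [hc, mul_one_div, div_le_iff₀ (by positivity)]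
      linarith
    have e2 : (D' - 1) * c' ≤ 1 / 4 := by
      rw [hc', mul_one_div, div_le_iff₀ (by positivity)]
      linarith
    have e3 := mul_le_mul_of_nonneg_right e1 hε0.le
    have e4 := mul_le_mul_of_nonneg_right e2 hε0.le
    rw [hnδ]
    have e5 : Λ * (c * ε * XB + 2 * (c' * ε)) + Λ * (1 + ρ ^ 2) * (2 * (c * ε) * K + c' * ε)
        = (D - 1) * c * ε + (D' - 1) * c' * ε := by
      rw [hD, hD']
      ring
    linarith
  rw [hΛ, hK] at herr
  have hθ1 : c * ε < 1 := by nlinarith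
  have hα' : 1 - α ∈ Set.Ioo (0 : ℝ) 1 := ⟨by linarith [hα.2], by linarith [hα.1]⟩
  have b1 : ∀ t, 5 * Real.log (1 / ε) ≤ t → α / (1 - α) * Real.exp (-t) ≤ ε / 8 :=
    fun t ht => div_mul_exp_le hα hε0 hεα' hε2 ht
  have b2 : ∀ t, 5 * Real.log (1 / ε) ≤ t → (1 - α) / α * Real.exp (-t) ≤ ε / 8 := fun t ht => by
    simpa only [sub_sub_cancel] using
      div_mul_exp_le hα' hε0 (by rwa [sub_sub_cancel]) hε2 ht
  constructor
  · refine isApproxEquilibrium_iu hwlo hw hXA hXB (δ := δ) (η := ε / 8) (θ := c * ε)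
      (isSharp_powerCSF hα hδ0 hR0 (b1 _ hpower) (b2 _ hpower)) ?_ hδ0 (by positivity)
      (by positivity) hθ1 hn0 h0 herr hε0.le hγ
    rw [powerCSF_B_swap]
    exact isSharp_powerCSF hα' hδ0 hR0 (by simpa only [sub_sub_cancel] using b2 _ hpower)
      (by simpa only [sub_sub_cancel] using b1 _ hpower)
  · refine isApproxEquilibrium_iu hwlo hw hXA hXB (δ := δ) (η := ε / 8) (θ := c * ε)
      (isSharp_logitCSF hα hR0 (b1 _ hlogit) (b2 _ hlogit)) ?_ hδ0 (by positivity)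
      (by positivity) hθ1 hn0 h0 herr hε0.le hγ
    rw [logitCSF_B_swap]
    exact isSharp_logitCSF hα' hR0 (by simpa only [sub_sub_cancel] using b2 _ hlogit)
      (by simpa only [sub_sub_cancel] using b1 _ hlogit)
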